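/- All graphs are finite, simple and undirected. A connected graph $G$ is bridgeless if no edge of it is a bridge. A set $D\subseteq V(G)$ is dominating if every vertex outside $D$ has a neighbour in $D$; the domination number of $G$ is the least size of a dominating set. An orientation of $G$ assigns one direction to each edge, and it is strong if there is a directed path from every vertex to every vertex. In a strong orientation $\vec G$, the strong distance $sd(u,v)$ is the minimum number of arcs in a strong subgraph of $\vec G$ containing $u$ and $v$, and the strong diameter is $sdiam(\vec G)=\max_{u,v} sd(u,v)$. The oriented strong diameter $\overrightarrow{sdiam}(G)$ is the minimum of $sdiam(\vec G)$ over all strong orientations $\vec G$ of $G$. **Theorem.** Let $G$ be a connected bridgeless graph and $D$ a dominating set of $G$ with $|D|=\gamma$. Then $G$ has a strong orientation of strong diameter at most $7\gamma-1$; that is, $\overrightarrow{sdiam}(G)\le 7\gamma-1$. The bound is sharp for every $\gamma\ge 1$: take a path $u_1\cdots u_\gamma$ and replace each edge $u_iu_{i+1}$ by either one of the following two graphs on $u_i$, $u_{i+1}$ and four new vertices $a_i,a_i',b_i,b_i'$: the union of the triangle $u_ia_ia_i'$ and the 4-cycle $a_ib_iu_{i+1}b_i'$, or the union of the 4-cycle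 $u_ia_ib_ia_i'$ and the triangle $b_ib_i'u_{i+1}$. Finally attach one triangle with two new vertices at $u_1$ and another triangle with two new vertices at $u_\gamma$ (both at the same vertex if $\gamma=1$). Every graph $G$ obtained in this way is connected and bridgeless, $\{u_1,\dots,u_\gamma\}$ is a dominating set of size $\gamma$, the domination number of $G$ is $\gamma$, and $\overrightarrow{sdiam}(G)=7\gamma-1$. -/

import Mathlib

/-- A simple graph is bridgeless if none of its edges is a bridge. -/
def IsBridgeless {V : Type*} (G : SimpleGraph V) : Prop :=
  ∀ e ∈ G.edgeSet, ¬ G.IsBridge e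

/-- `D` is a dominating set of `G`: every vertex outside `D` is adjacent to a vertex of `D`. -/
def IsDominatingSet {V : Type*} (G : SimpleGraph V) (D : Finset V) : Prop :=
  ∀ v, v ∉ D → ∃ d ∈ D, G.Adj v d

/-- The domination number of `G` equals `k`. -/
def HasDominationNumber {V : Type*} (G : SimpleGraph V) (k : ℕ) : Prop :=
  IsLeast {n : ℕ | ∃ D : Finset V, IsDominatingSet G D ∧ D.card = n} k

/-- The digraph `O` is an orientation of `G`: each edge of `G` is given exactly one of its two
directions, and `O` has no other arcs. -/
structure IsOrientation {V : Type*} (G : SimpleGraph V) (O : Digraph V) : Prop where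
  adj_iff : ∀ u v, G.Adj u v ↔ O.Adj u v ∨ O.Adj v u
  asymm : ∀ u v, O.Adj u v → ¬ O.Adj v u

/-- A digraph is strong if there is a directed path from every vertex to every vertex. -/
def IsStrong {V : Type*} (O : Digraph V) : Prop :=
  ∀ u v, Relation.ReflTransGen O.Adj u v

/-- A strong orientation of `G`. -/
def IsStrongOrientation {V : Type*} (G : SimpleGraph V) (O : Digraph V) : Prop :=
  IsOrientation G O ∧ IsStrong O

/-- A subgraph of a digraph: a set of vertices and a set of arcs between them. -/
structure SubDigraph {V : Type*} (O : Digraph V) where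
  verts : Set V
  Adj : V → V → Prop
  adj_sub : ∀ {u v}, Adj u v → O.Adj u v
  fst_mem : ∀ {u v}, Adj u v → u ∈ verts
  snd_mem : ∀ {u v}, Adj u v → v ∈ verts

/-- The subgraph is a strong digraph. -/
def SubDigraph.IsStrong {V : Type*} {O : Digraph V} (H : SubDigraph O) : Prop :=
  ∀ u ∈ H.verts, ∀ v ∈ H.verts, Relation.ReflTransGen H.Adj u v

/-- The number of arcs of a subgraph. -/
noncomputable def SubDigraph.numArcs {V : Type*} {O : Digraph V} (H : SubDigraph O) : ℕ∞ :=
  Set.encard {p : V × V | H.Adj p.1 p.2}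

/-- The strong distance of `u` and `v`: the minimum number of arcs of a strong subgraph of `O`
containing `u` and `v` (`⊤` if there is no such subgraph). -/
noncomputable def strongDist {V : Type*} (O : Digraph V) (u v : V) : ℕ∞ :=
  ⨅ (H : SubDigraph O) (_ : H.IsStrong) (_ : u ∈ H.verts) (_ : v ∈ H.verts), H.numArcs

/-- The strong diameter of `O`: the maximum of the strong distances. -/
noncomputable def strongDiam {V : Type*} (O : Digraph V) : ℕ∞ :=
  ⨆ (u : V) (v : V), strongDist O u v

/-- The oriented strong diameter of `G`: the minimum strong diameter of a strong orientation of
`G` (`⊤` if `G` has no strong orientation). -/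
noncomputable def orientedStrongDiam {V : Type*} (G : SimpleGraph V) : ℕ∞ :=
  ⨅ (O : Digraph V) (_ : IsStrongOrientation G O), strongDiam O

/-- A finite bound on the oriented strong diameter is a bound for some strong orientation. -/
theorem orientedStrongDiam_le_iff {V : Type*} (G : SimpleGraph V) (n : ℕ) :
    orientedStrongDiam G ≤ n ↔ ∃ O, IsStrongOrientation G O ∧ strongDiam O ≤ n := by
  constructor
  · intro h
    have h1 : orientedStrongDiam G < ((n + 1 : ℕ) : ℕ∞) :=
      lt_of_le_of_lt h (by exact_mod_cast Nat.lt_succ_self n)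
    simp only [orientedStrongDiam, iInf_lt_iff] at h1
    obtain ⟨O, hO, hlt⟩ := h1
    refine ⟨O, hO, ?_⟩
    have h2 : strongDiam O < (n : ℕ∞) + 1 := by exact_mod_cast hlt
    exact Order.le_of_lt_add_one h2
  · rintro ⟨O, hO, h⟩
    exact (iInf₂_le O hO).trans h

/-- Vertices of the extremal graph on a path `u_0, …, u_n`: the path vertices `hub i`, two vertices
`left i _` adjacent to `u_i` and two vertices `right i _` adjacent to `u_{i+1}` in the gadget
that replaces the edge `u_i u_{i+1}`, and two further vertices for each of the two end triangles. -/
inductive ExtremalVertex (n : ℕ) : Type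
  | hub (i : Fin (n + 1))
  | left (i : Fin n) (k : Bool)
  | right (i : Fin n) (k : Bool)
  | first (k : Bool)
  | last (k : Bool)

/-- The edges of the extremal graph. The gadget for `u_i u_{i+1}` is a triangle and a 4-cycle with
one vertex in common. If `c i = false` the triangle is `u_i, left i true, left i false` and the
4-cycle is `left i true, right i false, u_{i+1}, right i true`; if `c i = true` the gadget is
reflected. Triangles are attached at `u_0` and at `u_n`. -/
inductive ExtremalRel (n : ℕ) (c : Fin n → Bool) : ExtremalVertex n → ExtremalVertex n → Prop
  | hub_left (i : Fin n) (k : Bool) : ExtremalRel n c (.hub i.castSucc) (.left i k)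
  | hub_right (i : Fin n) (k : Bool) : ExtremalRel n c (.hub i.succ) (.right i k)
  | left_left (i : Fin n) (h : c i = false) : ExtremalRel n c (.left i true) (.left i false)
  | left_right (i : Fin n) (h : c i = false) (k : Bool) :
      ExtremalRel n c (.left i true) (.right i k)
  | right_right (i : Fin n) (h : c i = true) : ExtremalRel n c (.right i true) (.right i false)
  | right_left (i : Fin n) (h : c i = true) (k : Bool) :
      ExtremalRel n c (.right i true) (.left i k)
  | hub_first (k : Bool) : ExtremalRel n c (.hub 0) (.first k)
  | first_first : ExtremalRel n c (.first true) (.first false)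
  | hub_last (k : Bool) : ExtremalRel n c (.hub (Fin.last n)) (.last k)
  | last_last : ExtremalRel n c (.last true) (.last false)

/-- The extremal graph with `n + 1` path vertices; `c` selects the form of each gadget. -/
def extremalGraph (n : ℕ) (c : Fin n → Bool) : SimpleGraph (ExtremalVertex n) :=
  SimpleGraph.fromRel (ExtremalRel n c)

/-- The path vertices `u_0, …, u_n` of the extremal graph. -/
def extremalHubs (n : ℕ) : Finset (ExtremalVertex n) :=
  Finset.univ.map ⟨ExtremalVertex.hub, fun _ _ h => by injection h⟩

/-!
# Oriented strong diameter and domination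

**Upper bound.** Let `D` be a dominating set of the connected bridgeless graph `G`. It suffices to
find an orientable strong part of `G` that contains `D` and has at most `7 (|D| - 1)` arcs. For then
a vertex outside it lies on a directed ear with at most three arcs: a vertex all of whose neighbours
are in the strong part has two of them, and the others split into two classes `X` and `Y`, each
vertex having a neighbour in the other class, so that all edges can be directed from `D` to `X`,
from `X` to `Y` and from `Y` to `D`. Two vertices thus lie in a strong subgraph with at most
`7 (|D| - 1) + 3 + 3` arcs (`strongDist_le_of_ears`).

The strong part comes from an edge set `K` in which no removal of a single edge separates two
vertices of `D`; by an ear argument as in Robbins' theorem such a set has a strongly oriented part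
around `D` (`exists_isStrongPart`). To find `K`, assign to each vertex a home in `D`, and join the
stars by `|D| - 1` links to a spanning tree. Prune it to the tree `T` formed by the links and the
star edges at their ends. Every edge of `T` is covered by an edge of `G` that joins the two sides of
the tree, and such an edge becomes an ear by adding the star edges at those of its ends that are
outside `T`. An ear has at most three edges, and three only if both ends are outside `T`; when the
links are chosen to give `T` as many vertices as possible, this can happen only over links whose
ends lie outside `D` and have no other link, and over the star edges at these ends
(`IsMaxLinkSet.isLow_of_long`, an exchange argument). Moreover an edge that
covers the tree edge `xy` and does not end at `x` also covers another tree edge at `x`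
(`Covers.exists_adjacent`), which saves an ear where two are too expensive. With these savings the
edges of `T` and their ears amount to at most seven edges per link; since a vertex outside `D` may
be an end of several links, the count is a discharging argument (`sum_cost_le`).

**Sharpness.** In the extremal graphs the closed neighbourhoods of the path vertices partition the
vertices, so the domination number is the number of path vertices. Every edge belongs to a cut of
two edges that separates the two end triangles. A strong subgraph meeting both of them at the right
vertices uses both edges of each such cut, hence all `7 (n + 1) - 1` edges
(`extremalGraph_uses_all`).
-/

/-! ### Strong parts and Robbins' theorem -/

/-- The arc relation `A` on the vertex set `W` is a strong, asymmetric digraph whose arcs are edges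
of `K`. -/
structure IsStrongPart {V : Type*} (K : SimpleGraph V) (W : Finset V) (A : V → V → Prop) :
    Prop where
  adj : ∀ {u v}, A u v → K.Adj u v
  fst_mem : ∀ {u v}, A u v → u ∈ W
  snd_mem : ∀ {u v}, A u v → v ∈ W
  asymm : ∀ {u v}, A u v → ¬ A v u
  strong : ∀ {u v}, u ∈ W → v ∈ W → Relation.ReflTransGen A u v

/-- Walking along a walk, every arc belongs to the relation given by its darts. -/
theorem SimpleGraph.Walk.reflTransGen_darts {V : Type*} {K : SimpleGraph V} {x y : V}
    (p : K.Walk x y) :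
    ∀ u ∈ p.support,
      Relation.ReflTransGen (fun a b => ∃ h : K.Adj a b, (⟨(a, b), h⟩ : K.Dart) ∈ p.darts) x u ∧
      Relation.ReflTransGen (fun a b => ∃ h : K.Adj a b, (⟨(a, b), h⟩ : K.Dart) ∈ p.darts) u y := by
  induction p with
  | nil => intro u hu; simp at hu; subst hu; exact ⟨.refl, .refl⟩
  | @cons a b c h p ih =>
    have mono : ∀ {s t}, Relation.ReflTransGen
        (fun a b => ∃ h : K.Adj a b, (⟨(a, b), h⟩ : K.Dart) ∈ p.darts) s t →
        Relation.ReflTransGen (fun a' b' => ∃ h' : K.Adj a' b',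
          (⟨(a', b'), h'⟩ : K.Dart) ∈ (SimpleGraph.Walk.cons h p).darts) s t := by
      intro s t hst
      refine Relation.ReflTransGen.mono ?_ _ _ hst
      rintro s t ⟨h1, h2⟩
      exact ⟨h1, by simp [h2]⟩
    have h0 : Relation.ReflTransGen (fun a' b' => ∃ h' : K.Adj a' b',
          (⟨(a', b'), h'⟩ : K.Dart) ∈ (SimpleGraph.Walk.cons h p).darts) a b :=
      .single ⟨h, by simp⟩
    intro u hu
    rw [SimpleGraph.Walk.support_cons, List.mem_cons] at hu
    rcases hu with rfl | hu
    · exact ⟨.refl, h0.trans (mono (ih b p.start_mem_support).2)⟩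
    · exact ⟨h0.trans (mono (ih u hu).1), mono (ih u hu).2⟩

theorem SimpleGraph.Walk.IsTrail.not_symm_mem_darts {V : Type*} {K : SimpleGraph V} {x y : V}
    {p : K.Walk x y} (hp : p.IsTrail) {a b : V} (h : K.Adj a b) (h' : K.Adj b a)
    (h1 : (⟨(a, b), h⟩ : K.Dart) ∈ p.darts) : (⟨(b, a), h'⟩ : K.Dart) ∉ p.darts := by
  intro h2
  have hn : (p.darts.map SimpleGraph.Dart.edge).Nodup := hp.edges_nodup
  have := List.inj_on_of_nodup_map hn h1 h2 (by simp [SimpleGraph.Dart.edge, Sym2.eq_swap])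
  simp at this
  exact h.ne this.1

/-- Adding a directed ear to a strong part. -/
theorem IsStrongPart.add_ear {V : Type*} [DecidableEq V] {K : SimpleGraph V} {W : Finset V}
    {A : V → V → Prop} (hA : IsStrongPart K W A) {w w' x x' : V} (hw : w ∈ W) (hw' : w' ∈ W)
    (p : K.Walk x x') (hp : p.IsPath) (hpW : ∀ u ∈ p.support, u ∉ W) (h1 : K.Adj w x)
    (h2 : K.Adj x' w') (hne : ¬ (x = x' ∧ w = w')) :
    ∃ A', IsStrongPart K (W ∪ p.support.toFinset) A' := by
  have hxW := hpW x p.start_mem_support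
  have hx'W := hpW x' p.end_mem_support
  let P : V → V → Prop := fun a b => ∃ h : K.Adj a b, (⟨(a, b), h⟩ : K.Dart) ∈ p.darts
  have hP1 : ∀ {a b}, P a b → a ∈ p.support := fun ⟨h, hd⟩ => p.dart_fst_mem_support_of_mem_darts hd
  have hP2 : ∀ {a b}, P a b → b ∈ p.support := fun ⟨h, hd⟩ => p.dart_snd_mem_support_of_mem_darts hd
  let A' : V → V → Prop := fun a b => A a b ∨ P a b ∨ (a = w ∧ b = x) ∨ (a = x' ∧ b = w')
  have hAA' : ∀ {a b}, Relation.ReflTransGen A a b → Relation.ReflTransGen A' a b :=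
    Relation.ReflTransGen.mono (fun _ _ h => Or.inl h) _ _
  have hPA' : ∀ {a b}, Relation.ReflTransGen P a b → Relation.ReflTransGen A' a b :=
    Relation.ReflTransGen.mono (fun _ _ h => Or.inr (Or.inl h)) _ _
  have hwx : A' w x := Or.inr (Or.inr (Or.inl ⟨rfl, rfl⟩))
  have hxw : A' x' w' := Or.inr (Or.inr (Or.inr ⟨rfl, rfl⟩))
  have hr1 : ∀ u ∈ W ∪ p.support.toFinset, Relation.ReflTransGen A' u w := by
    intro u hu
    rw [Finset.mem_union, List.mem_toFinset] at hu
    rcases hu with hu | hu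
    · exact hAA' (hA.strong hu hw)
    · exact ((hPA' (p.reflTransGen_darts u hu).2).tail hxw).trans
        (hAA' (hA.strong hw' hw))
  have hr2 : ∀ u ∈ W ∪ p.support.toFinset, Relation.ReflTransGen A' w u := by
    intro u hu
    rw [Finset.mem_union, List.mem_toFinset] at hu
    rcases hu with hu | hu
    · exact hAA' (hA.strong hw hu)
    · exact (Relation.ReflTransGen.single hwx).trans
        (hPA' (p.reflTransGen_darts u hu).1)
  refine ⟨A', ?_, ?_, ?_, ?_, fun hu hv => (hr1 _ hu).trans (hr2 _ hv)⟩
  · rintro u v (h | ⟨h, -⟩ | ⟨rfl, rfl⟩ | ⟨rfl, rfl⟩)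
    exacts [hA.adj h, h, h1, h2]
  · rintro u v (h | h | ⟨rfl, rfl⟩ | ⟨rfl, rfl⟩)
    · exact Finset.mem_union_left _ (hA.fst_mem h)
    · exact Finset.mem_union_right _ (List.mem_toFinset.2 (hP1 h))
    · exact Finset.mem_union_left _ hw
    · exact Finset.mem_union_right _ (by simp)
  · rintro u v (h | h | ⟨rfl, rfl⟩ | ⟨rfl, rfl⟩)
    · exact Finset.mem_union_left _ (hA.snd_mem h)
    · exact Finset.mem_union_right _ (List.mem_toFinset.2 (hP2 h))
    · exact Finset.mem_union_right _ (by simp)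
    · exact Finset.mem_union_left _ hw'
  · rintro u v (h | h | ⟨rfl, rfl⟩ | ⟨rfl, rfl⟩) (h' | h' | ⟨h3, h4⟩ | ⟨h3, h4⟩)
    · exact hA.asymm h h'
    · exact hpW _ (hP1 h') (hA.snd_mem h)
    · exact hxW (h4 ▸ hA.fst_mem h)
    · exact hx'W (h3 ▸ hA.snd_mem h)
    · exact hpW _ (hP1 h) (hA.snd_mem h')
    · obtain ⟨ha, hd⟩ := h
      obtain ⟨ha', hd'⟩ := h'
      exact hp.isTrail.not_symm_mem_darts ha ha' hd hd'
    · exact hpW _ (hP2 h) (h3 ▸ hw)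
    · exact hpW _ (hP1 h) (h4 ▸ hw')
    · exact hxW (hA.fst_mem h')
    · exact hpW _ (hP2 h') hw
    · exact hxW (h3 ▸ hw)
    · exact hne ⟨h3, h4⟩
    · exact hx'W (hA.snd_mem h')
    · exact hpW _ (hP1 h') hw'
    · exact hne ⟨h4.symm, h3.symm⟩
    · exact hx'W (h4 ▸ hw')

/-- If `r` stays connected to every vertex of `D` after the removal of any one edge of `K`, then
`K` has a strongly oriented part that contains `r` and `D`: this is Robbins' theorem for the block
of `r`. -/
theorem exists_isStrongPart {V : Type*} [Finite V] (K : SimpleGraph V) (r : V) (D : Finset V)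
    (h : ∀ e, ∀ d ∈ D, (K.deleteEdges {e}).Reachable r d) :
    ∃ W A, IsStrongPart K W A ∧ r ∈ W ∧ D ⊆ W := by
  classical
  have := Fintype.ofFinite V
  let S : Finset (Finset V) := Finset.univ.filter fun W => r ∈ W ∧ ∃ A, IsStrongPart K W A
  have hS : S.Nonempty := by
    refine ⟨{r}, ?_⟩
    simp only [S, Finset.mem_filter, Finset.mem_univ, Finset.mem_singleton, true_and]
    refine ⟨fun _ _ => False, by simp, by simp, by simp, by simp, ?_⟩
    intro u v hu hv
    rw [Finset.mem_singleton] at hu hv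
    subst hu; subst hv; exact .refl
  obtain ⟨W, hW, hmax⟩ := S.exists_max_image Finset.card hS
  simp only [S, Finset.mem_filter, Finset.mem_univ, true_and] at hW hmax
  obtain ⟨hrW, A, hA⟩ := hW
  refine ⟨W, A, hA, hrW, fun d hd => ?_⟩
  by_contra hdW
  -- the vertices that `d` reaches without entering `W`
  let C : Set V := {x | ∃ p : K.Walk d x, ∀ u ∈ p.support, u ∉ W}
  have hdC : d ∈ C := ⟨.nil, by simpa using hdW⟩
  have hrC : r ∉ C := fun ⟨p, hp⟩ => hp r p.end_mem_support hrW
  -- after the removal of `e`, an edge still leaves `C`, and it leaves into `W`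
  have key : ∀ e, ∃ x w, x ∈ C ∧ w ∈ W ∧ K.Adj x w ∧ s(x, w) ≠ e := by
    intro e
    obtain ⟨q⟩ := (h e d hd).symm
    obtain ⟨b, -, hb1, hb2⟩ := q.exists_boundary_dart C hdC hrC
    have hadj := b.adj
    rw [SimpleGraph.deleteEdges_adj] at hadj
    refine ⟨b.fst, b.snd, hb1, ?_, hadj.1, fun h => hadj.2 (by simpa using h)⟩
    by_contra hbW
    obtain ⟨p, hp⟩ := hb1
    refine hb2 ⟨p.concat hadj.1, fun u hu => ?_⟩
    rw [SimpleGraph.Walk.support_concat] at hu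
    simp only [List.mem_append, List.mem_singleton] at hu
    rcases hu with hu | rfl
    exacts [hp u hu, hbW]
  obtain ⟨x, w, hx, hw, hxw, -⟩ := key s(d, d)
  obtain ⟨x', w', hx', hw', hxw', hne⟩ := key s(x, w)
  obtain ⟨p, hp⟩ := hx
  obtain ⟨p', hp'⟩ := hx'
  let q := p.reverse.append p'
  have hq : ∀ u ∈ q.toPath.1.support, u ∉ W := by
    intro u hu
    have := q.support_toPath_subset_support hu
    simp only [q, SimpleGraph.Walk.mem_support_append_iff, SimpleGraph.Walk.support_reverse,
      List.mem_reverse] at this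
    rcases this with h | h
    exacts [hp u h, hp' u h]
  obtain ⟨A', hA'⟩ := hA.add_ear hw hw' q.toPath.1 q.toPath.2 hq hxw.symm hxw' (by
    rintro ⟨rfl, rfl⟩; exact hne rfl)
  have h1 := hmax _ ⟨Finset.mem_union_left _ hrW, A', hA'⟩
  have h2 : W ⊂ W ∪ q.toPath.1.support.toFinset := by
    refine Finset.ssubset_iff_subset_ne.2 ⟨Finset.subset_union_left, fun h => ?_⟩
    refine hq x (SimpleGraph.Walk.start_mem_support _) ?_
    rw [h]
    exact Finset.mem_union_right _ (by simp)
  exact absurd (Finset.card_lt_card h2) (not_lt.2 h1)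

/-- The arcs of a strong part are at most as many as the edges. -/
theorem IsStrongPart.encard_le {V : Type*} {K : SimpleGraph V} {W : Finset V}
    {A : V → V → Prop} (hA : IsStrongPart K W A) :
    Set.encard {p : V × V | A p.1 p.2} ≤ K.edgeSet.encard := by
  refine Set.encard_le_encard_of_injOn (f := fun p => s(p.1, p.2)) (fun p hp => hA.adj hp) ?_
  rintro ⟨a, b⟩ hp ⟨c, d⟩ hq h
  simp only [Set.mem_ofPred_eq] at hp hq
  rcases Sym2.eq_iff.1 h with ⟨rfl, rfl⟩ | ⟨rfl, rfl⟩
  · rfl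
  · exact absurd hq (hA.asymm hp)

/-! ### Edges covering a tree edge -/

/-- The edge `zz'` of `G` covers the edge `xy` of the tree `T`: it joins the two components of
`T - xy`, with `z` on the side of `x` and `z'` on the side of `y`. -/
structure Covers {V : Type*} (G T : SimpleGraph V) (x y z z' : V) : Prop where
  tree : T.Adj x y
  adj : G.Adj z z'
  ne : s(z, z') ≠ s(x, y)
  left : (T.deleteEdges {s(x, y)}).Reachable x z
  right : (T.deleteEdges {s(x, y)}).Reachable y z'

theorem Covers.symm {V : Type*} {G T : SimpleGraph V} {x y z z' : V} (h : Covers G T x y z z') :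
    Covers G T y x z' z := by
  refine ⟨h.tree.symm, h.adj.symm, ?_, ?_, ?_⟩
  · rw [Sym2.eq_swap, Sym2.eq_swap (a := y)]; exact h.ne
  · rw [Sym2.eq_swap]; exact h.right
  · rw [Sym2.eq_swap]; exact h.left

/-- Every vertex of a connected graph stays connected to an end of a removed edge. -/
theorem reachable_deleteEdges_or {V : Type*} {T : SimpleGraph V} (hT : T.Connected) (x y a : V) :
    (T.deleteEdges {s(x, y)}).Reachable x a ∨ (T.deleteEdges {s(x, y)}).Reachable y a := by
  obtain ⟨p⟩ := hT.preconnected x a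
  suffices H : ∀ {b c}, T.Walk b c →
      ((T.deleteEdges {s(x, y)}).Reachable x b ∨ (T.deleteEdges {s(x, y)}).Reachable y b) →
      ((T.deleteEdges {s(x, y)}).Reachable x c ∨ (T.deleteEdges {s(x, y)}).Reachable y c) from
    H p (Or.inl .rfl)
  intro b c q
  induction q with
  | nil => exact id
  | @cons b b' c h q ih =>
    intro hb
    apply ih
    by_cases he : s(b, b') = s(x, y)
    · rcases Sym2.eq_iff.1 he with ⟨-, rfl⟩ | ⟨-, rfl⟩
      exacts [Or.inr .rfl, Or.inl .rfl]
    · have : (T.deleteEdges {s(x, y)}).Reachable b b' :=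
        (SimpleGraph.deleteEdges_adj.2 ⟨h, by simpa using he⟩).reachable
      exact hb.imp (·.trans this) (·.trans this)

theorem SimpleGraph.IsTree.not_reachable_deleteEdges {V : Type*} {T : SimpleGraph V}
    (hT : T.IsTree) {x y : V} (h : T.Adj x y) : ¬ (T.deleteEdges {s(x, y)}).Reachable x y :=
  SimpleGraph.isBridge_iff.1 (SimpleGraph.isAcyclic_iff_forall_isBridge.1 hT.isAcyclic h)

/-- In a bridgeless graph every edge of a spanning tree is covered. -/
theorem exists_covers {V : Type*} {G T : SimpleGraph V} (hG : IsBridgeless G) (hTG : T ≤ G)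
    (hT : T.IsTree) {x y : V} (h : T.Adj x y) : ∃ z z', Covers G T x y z z' := by
  have hb := hG s(x, y) (hTG h)
  rw [SimpleGraph.isBridge_iff, not_not] at hb
  obtain ⟨p⟩ := hb
  obtain ⟨d, -, h1, h2⟩ := p.exists_boundary_dart
    {v | (T.deleteEdges {s(x, y)}).Reachable x v} (SimpleGraph.Reachable.rfl)
    (hT.not_reachable_deleteEdges h)
  have hd := SimpleGraph.deleteEdges_adj.1 d.adj
  exact ⟨d.fst, d.snd, h, hd.1, fun he => hd.2 (by simpa using he), h1,
    (reachable_deleteEdges_or hT.connected x y d.snd).resolve_left h2⟩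

/-- A covering edge that does not end at `x` covers a further tree edge at `x`: the first one on
the way from `x` to that end. -/
theorem Covers.exists_adjacent {V : Type*} {G T : SimpleGraph V} (hT : T.IsTree) {x y z z' : V}
    (h : Covers G T x y z z') (hz : z ≠ x) : ∃ y₁, y₁ ≠ y ∧ Covers G T y₁ x z z' := by
  obtain ⟨p, hp⟩ := h.left.exists_isPath
  cases p with
  | nil => exact absurd rfl hz
  | @cons _ y₁ _ hxy p =>
    rw [SimpleGraph.Walk.cons_isPath_iff] at hp
    have hadj := SimpleGraph.deleteEdges_adj.1 hxy
    have hne : y₁ ≠ y := by rintro rfl; exact hadj.2 rfl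
    have hx' : ¬ (T.deleteEdges {s(x, y)}).Reachable y x :=
      fun h' => hT.not_reachable_deleteEdges h.tree h'.symm
    have hleft : (T.deleteEdges {s(y₁, x)}).Reachable y₁ z := by
      refine ⟨p.transfer _ fun e he => ?_⟩
      have h1 := p.edges_subset_edgeSet he
      rw [SimpleGraph.edgeSet_deleteEdges] at h1 ⊢
      refine ⟨h1.1, ?_⟩
      rintro rfl
      exact hp.2 (p.snd_mem_support_of_mem_edges he)
    have hyx : (T.deleteEdges {s(y₁, x)}).Adj y x := by
      rw [SimpleGraph.deleteEdges_adj]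
      refine ⟨h.tree.symm, fun h' => ?_⟩
      rcases Sym2.eq_iff.1 h' with ⟨h', -⟩ | ⟨h', h''⟩
      exacts [hne h'.symm, h.tree.ne h'.symm]
    have hright : (T.deleteEdges {s(y₁, x)}).Reachable x z' := by
      obtain ⟨q⟩ := h.right
      refine hyx.symm.reachable.trans ⟨q.transfer _ fun e he => ?_⟩
      have h1 := q.edges_subset_edgeSet he
      rw [SimpleGraph.edgeSet_deleteEdges] at h1 ⊢
      refine ⟨h1.1, ?_⟩
      rintro rfl
      classical
      exact hx' ⟨q.takeUntil _ (q.snd_mem_support_of_mem_edges he)⟩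
    refine ⟨y₁, hne, hadj.1.symm, h.adj, fun he => ?_, hleft, hright⟩
    -- `zz'` is not a tree edge, since it joins the two sides of `T - xy`
    have h2 : (T.deleteEdges {s(x, y)}).Adj z z' := by
      rw [SimpleGraph.deleteEdges_adj]
      refine ⟨?_, fun h' => h.ne h'⟩
      rw [← SimpleGraph.mem_edgeSet, he]
      exact hadj.1.symm
    exact hx' (h.right.trans (h2.symm.reachable.trans h.left.symm))

/-! ### Spanning trees made of stars and links -/

/-- `φ` sends every vertex to a vertex of the dominating set `D`, its home, that is equal or
adjacent to it. -/
structure IsHomeMap {V : Type*} (G : SimpleGraph V) (D : Finset V) (φ : V → V) : Prop where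
  mem : ∀ v, φ v ∈ D
  fix : ∀ d ∈ D, φ d = d
  adj : ∀ v, v ∉ D → G.Adj v (φ v)

theorem IsDominatingSet.exists_isHomeMap {V : Type*} {G : SimpleGraph V} {D : Finset V}
    (h : IsDominatingSet G D) : ∃ φ, IsHomeMap G D φ := by
  classical
  choose! f hf using h
  refine ⟨fun v => if v ∈ D then v else f v, fun v => ?_, fun d hd => by simp [hd], fun v hv => ?_⟩
  · by_cases hv : v ∈ D
    · simp [hv]
    · simpa [hv] using (hf v hv).1
  · simpa [hv] using (hf v hv).2

/-- The graph formed by the stars of a home map and a set `M` of further edges, the links. -/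
def starTree {V : Type*} (φ : V → V) (M : Finset (Sym2 V)) : SimpleGraph V :=
  SimpleGraph.fromEdgeSet ({e | ∃ v, e = s(v, φ v)} ∪ M)

theorem starTree_adj {V : Type*} {φ : V → V} {M : Finset (Sym2 V)} {a b : V} :
    (starTree φ M).Adj a b ↔ (φ a = b ∨ φ b = a ∨ s(a, b) ∈ M) ∧ a ≠ b := by
  rw [starTree, SimpleGraph.fromEdgeSet_adj]
  refine and_congr_left fun _ => ?_
  simp only [Set.mem_union, Set.mem_ofPred_eq, Finset.mem_coe, ← or_assoc]
  refine or_congr_left ⟨?_, ?_⟩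
  · rintro ⟨v, hv⟩
    rcases Sym2.eq_iff.1 hv with ⟨rfl, rfl⟩ | ⟨rfl, rfl⟩
    exacts [Or.inl rfl, Or.inr rfl]
  · rintro (rfl | rfl)
    exacts [⟨a, rfl⟩, ⟨b, Sym2.eq_swap⟩]

/-- `M` is a set of links that joins the stars of the home map `φ` to a spanning tree. The bound on
its size is the one that makes the connected graph `starTree φ M` a tree. -/
structure IsLinkSet {V : Type*} (G : SimpleGraph V) (D : Finset V) (φ : V → V)
    (M : Finset (Sym2 V)) : Prop where
  sub : ∀ e ∈ M, e ∈ G.edgeSet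
  card : M.card + 1 ≤ D.card
  conn : (starTree φ M).Connected

theorem IsLinkSet.le {V : Type*} {G : SimpleGraph V} {D : Finset V} {φ : V → V}
    {M : Finset (Sym2 V)} (hφ : IsHomeMap G D φ) (hM : IsLinkSet G D φ M) : starTree φ M ≤ G := by
  have h1 : ∀ {a b}, φ a = b → a ≠ b → G.Adj a b := by
    rintro a b rfl hne
    exact hφ.adj a fun ha => hne (hφ.fix a ha).symm
  intro a b h
  rw [starTree_adj] at h
  obtain ⟨h | h | h, hne⟩ := h
  exacts [h1 h hne, (h1 h hne.symm).symm, hM.sub _ h]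

theorem IsLinkSet.isTree {V : Type*} [Finite V] {G : SimpleGraph V} {D : Finset V} {φ : V → V}
    {M : Finset (Sym2 V)} (hφ : IsHomeMap G D φ) (hM : IsLinkSet G D φ M) :
    (starTree φ M).IsTree := by
  classical
  have := Fintype.ofFinite V
  rw [SimpleGraph.isTree_iff_connected_and_card]
  refine ⟨hM.conn, le_antisymm ?_ hM.conn.card_vert_le_card_edgeSet_add_one⟩
  let F : Finset (Sym2 V) := Dᶜ.image (fun v => s(v, φ v)) ∪ M
  have hF : (starTree φ M).edgeSet ⊆ F := by
    intro e
    induction e with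
    | h a b =>
      intro h
      rw [SimpleGraph.mem_edgeSet, starTree_adj] at h
      have h1 : ∀ {a b}, φ a = b → a ≠ b → s(a, b) ∈ Dᶜ.image (fun v => s(v, φ v)) := by
        rintro a b rfl hne
        exact Finset.mem_image.2 ⟨a, Finset.mem_compl.2 fun ha => hne (hφ.fix a ha).symm, rfl⟩
      simp only [F, Finset.coe_union, Set.mem_union, Finset.mem_coe]
      obtain ⟨h | h | h, hne⟩ := h
      · exact Or.inl (h1 h hne)
      · rw [Sym2.eq_swap]; exact Or.inl (h1 h hne.symm)
      · exact Or.inr h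
  have h1 : Nat.card (starTree φ M).edgeSet ≤ F.card := by
    have := Set.ncard_le_ncard hF
    rwa [Set.ncard_coe_finset] at this
  have h2 : F.card ≤ Dᶜ.card + M.card :=
    (Finset.card_union_le _ _).trans (by gcongr; exact Finset.card_image_le)
  have h3 := hM.card
  have h4 := Finset.card_compl_add_card D
  rw [Nat.card_eq_fintype_card (α := V)]
  omega

/-- Every connected graph has a link set: a spanning tree of the quotient by the stars. -/
theorem exists_isLinkSet {V : Type*} [Finite V] {G : SimpleGraph V} {D : Finset V} {φ : V → V}
    (hG : G.Connected) (hφ : IsHomeMap G D φ) : ∃ M, IsLinkSet G D φ M := by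
  classical
  have := Fintype.ofFinite V
  let ψ : V → D := fun v => ⟨φ v, hφ.mem v⟩
  let Q : SimpleGraph D := SimpleGraph.fromRel fun a b => ∃ u v, G.Adj u v ∧ ψ u = a ∧ ψ v = b
  have hQadj : ∀ {u v}, G.Adj u v → Q.Reachable (ψ u) (ψ v) := by
    intro u v h
    by_cases he : ψ u = ψ v
    · rw [he]
    · exact SimpleGraph.Adj.reachable (by
        rw [SimpleGraph.fromRel_adj]; exact ⟨he, Or.inl ⟨u, v, h, rfl, rfl⟩⟩)
  have hQ : Q.Connected := by
    obtain ⟨v₀⟩ := hG.nonempty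
    rw [SimpleGraph.connected_iff_exists_forall_reachable]
    refine ⟨ψ v₀, fun d => ?_⟩
    obtain ⟨p⟩ := hG.preconnected v₀ d
    have hd : ψ d = d := Subtype.ext (hφ.fix d d.2)
    suffices H : ∀ {a b}, G.Walk a b → Q.Reachable (ψ a) (ψ b) from hd ▸ H p
    intro a b p
    induction p with
    | nil => exact .rfl
    | cons h p ih => exact (hQadj h).trans ih
  obtain ⟨S, hSQ, hS⟩ := hQ.exists_isTree_le
  have hex : ∀ e ∈ S.edgeSet, ∃ u v, G.Adj u v ∧ e = s(ψ u, ψ v) := by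
    intro e
    induction e with
    | h a b =>
      intro h
      have := hSQ h
      rw [SimpleGraph.fromRel_adj] at this
      obtain ⟨-, ⟨u, v, h1, rfl, rfl⟩ | ⟨u, v, h1, rfl, rfl⟩⟩ := this
      exacts [⟨u, v, h1, rfl⟩, ⟨u, v, h1, Sym2.eq_swap⟩]
  have := hG.nonempty
  choose! f g hfg using hex
  refine ⟨S.edgeFinset.image fun e => s(f e, g e), ?_, ?_, ?_⟩
  · intro e he
    obtain ⟨e', he', rfl⟩ := Finset.mem_image.1 he
    exact (hfg e' (SimpleGraph.mem_edgeFinset.1 he')).1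
  · have h1 := hS.card_edgeFinset
    rw [Fintype.card_coe] at h1
    rw [← h1]
    exact Nat.succ_le_succ Finset.card_image_le
  · set T := starTree φ (S.edgeFinset.image fun e => s(f e, g e)) with hTdef
    have hstar : ∀ v, T.Reachable v (φ v) := by
      intro v
      by_cases h : v = φ v
      · rw [← h]
      · exact SimpleGraph.Adj.reachable (starTree_adj.2 ⟨Or.inl rfl, h⟩)
    have hS' : ∀ a b : D, S.Adj a b → T.Reachable a b := by
      intro a b h
      obtain ⟨h1, h2⟩ := hfg s(a, b) h
      have h3 : T.Reachable (f s(a, b)) (g s(a, b)) :=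
        SimpleGraph.Adj.reachable (starTree_adj.2 ⟨Or.inr (Or.inr (Finset.mem_image.2
          ⟨s(a, b), SimpleGraph.mem_edgeFinset.2 h, rfl⟩)), h1.ne⟩)
      have h4 := (hstar (f s(a, b))).symm.trans (h3.trans (hstar (g s(a, b))))
      rcases Sym2.eq_iff.1 h2 with ⟨h5, h6⟩ | ⟨h5, h6⟩
      · rw [show (a : V) = _ from congrArg Subtype.val h5,
          show (b : V) = _ from congrArg Subtype.val h6]
        exact h4
      · rw [show (a : V) = _ from congrArg Subtype.val h5,
          show (b : V) = _ from congrArg Subtype.val h6]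
        exact h4.symm
    have hSr : ∀ {a b : D}, S.Walk a b → T.Reachable a b := by
      intro a b p
      induction p with
      | nil => exact .rfl
      | cons h p ih => exact (hS' _ _ h).trans ih
    obtain ⟨v₀⟩ := hG.nonempty
    rw [SimpleGraph.connected_iff_exists_forall_reachable]
    refine ⟨φ v₀, fun v => ?_⟩
    obtain ⟨p⟩ := hS.connected.preconnected (ψ v₀) (ψ v)
    exact (hSr p).trans (hstar v).symm

/-! ### Ears over the edges of the pruned tree -/

section

variable {V : Type*} [Fintype V] [DecidableEq V]

/-- The vertices of `D` and the ends of links. The tree `starTree φ M`, pruned of the leaves outside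
`D`, has this vertex set. -/
def core (D : Finset V) (M : Finset (Sym2 V)) : Finset V :=
  Finset.univ.filter fun v => v ∈ D ∨ ∃ e ∈ M, v ∈ e

/-- The number of links at a vertex. -/
def linkDegree (M : Finset (Sym2 V)) (v : V) : ℕ := (M.filter (v ∈ ·)).card

/-- A vertex outside `D` with exactly one link. -/
def IsLow (D : Finset V) (M : Finset (Sym2 V)) (v : V) : Prop := v ∉ D ∧ linkDegree M v = 1

/-- A vertex outside `D` with exactly two links, both of which lead to low vertices. -/
def IsSpecial (D : Finset V) (M : Finset (Sym2 V)) (v : V) : Prop :=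
  v ∉ D ∧ linkDegree M v = 2 ∧ ∀ e ∈ M, v ∈ e → ∀ w ∈ e, w ≠ v → IsLow D M w

/-- A link set with the largest possible core. -/
def IsMaxLinkSet (G : SimpleGraph V) (D : Finset V) (φ : V → V) (M : Finset (Sym2 V)) : Prop :=
  IsLinkSet G D φ M ∧ ∀ M', IsLinkSet G D φ M' → (core D M').card ≤ (core D M).card

/-- The ear of the edge `g`: the edge itself and the star edges at its ends outside the core. -/
def earEdges (φ : V → V) (C : Finset V) (g : Sym2 V) : Finset (Sym2 V) :=
  insert g ((g.toFinset \ C).image fun v => s(v, φ v))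

/-- `R` is the ear of an edge that covers `f`. -/
def HasEar (G : SimpleGraph V) (D : Finset V) (φ : V → V) (M : Finset (Sym2 V)) (f : Sym2 V)
    (R : Finset (Sym2 V)) : Prop :=
  ∃ x y z z', f = s(x, y) ∧ Covers G (starTree φ M) x y z z' ∧
    R = earEdges φ (core D M) s(z, z')

/-- `K` contains `f` and an ear that covers it. -/
def Secures (G : SimpleGraph V) (D : Finset V) (φ : V → V) (M K : Finset (Sym2 V))
    (f : Sym2 V) : Prop :=
  f ∈ K ∧ ∃ R ⊆ K, HasEar G D φ M f R

theorem Secures.mono {G : SimpleGraph V} {D : Finset V} {φ : V → V} {M K K' : Finset (Sym2 V)}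
    {f : Sym2 V} (h : Secures G D φ M K f) (hK : K ⊆ K') : Secures G D φ M K' f :=
  ⟨hK h.1, h.2.imp fun _ hR => ⟨hR.1.trans hK, hR.2⟩⟩

omit [Fintype V] in
theorem card_earEdges_le (φ : V → V) (C : Finset V) (z z' : V) :
    (earEdges φ C s(z, z')).card ≤ 3 := by
  refine (Finset.card_insert_le _ _).trans (Nat.succ_le_succ (Finset.card_image_le.trans ?_))
  rw [Sym2.toFinset_mk_eq]
  exact (Finset.card_le_card Finset.sdiff_subset).trans Finset.card_le_two

omit [Fintype V] in
theorem card_earEdges_le_two (φ : V → V) (C : Finset V) {z z' : V} (h : z ∈ C ∨ z' ∈ C) :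
    (earEdges φ C s(z, z')).card ≤ 2 := by
  refine (Finset.card_insert_le _ _).trans (Nat.succ_le_succ (Finset.card_image_le.trans ?_))
  rw [Sym2.toFinset_mk_eq]
  rcases h with h | h
  · exact (Finset.card_le_card (t := {z'}) (by intro v; simp; grind)).trans_eq (by simp)
  · exact (Finset.card_le_card (t := {z}) (by intro v; simp; grind)).trans_eq (by simp)

theorem mem_core {D : Finset V} {M : Finset (Sym2 V)} {v : V} :
    v ∈ core D M ↔ v ∈ D ∨ ∃ e ∈ M, v ∈ e := by simp [core]

theorem mem_core_left {D : Finset V} {M : Finset (Sym2 V)} {x y : V} (h : s(x, y) ∈ M) :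
    x ∈ core D M := mem_core.2 (Or.inr ⟨_, h, by simp⟩)

omit [Fintype V] in
theorem IsLow.eq_of_mem {D : Finset V} {M : Finset (Sym2 V)} {x : V} (h : IsLow D M x)
    {e e' : Sym2 V} (he : e ∈ M) (he' : e' ∈ M) (hx : x ∈ e) (hx' : x ∈ e') : e = e' :=
  Finset.card_le_one.1 h.2.le e (Finset.mem_filter.2 ⟨he, hx⟩) e' (Finset.mem_filter.2 ⟨he', hx'⟩)

omit [Fintype V] in
theorem IsLow.other_eq {D : Finset V} {M : Finset (Sym2 V)} {x y y₁ : V} (h : IsLow D M x)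
    (hy : s(x, y) ∈ M) (hy₁ : s(x, y₁) ∈ M) : y₁ = y :=
  Sym2.congr_right.1 (h.eq_of_mem hy₁ hy (by simp) (by simp))

variable {G : SimpleGraph V} {D : Finset V} {φ : V → V} {M : Finset (Sym2 V)}

omit [Fintype V] [DecidableEq V] in
/-- Tree edges at a vertex outside `D` are the star edge and the links. -/
theorem IsHomeMap.eq_or_mem_of_adj (hφ : IsHomeMap G D φ) {x y : V} (hx : x ∉ D)
    (h : (starTree φ M).Adj y x) : y = φ x ∨ s(x, y) ∈ M := by
  rw [starTree_adj] at h
  obtain ⟨h | h | h, -⟩ := h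
  · exact absurd (h ▸ hφ.mem y) hx
  · exact Or.inl h.symm
  · exact Or.inr (Sym2.eq_swap ▸ h)

omit [Fintype V] [DecidableEq V] in
theorem IsHomeMap.starTree_adj_home (hφ : IsHomeMap G D φ) {x : V} (hx : x ∉ D) :
    (starTree φ M).Adj x (φ x) :=
  starTree_adj.2 ⟨Or.inl rfl, fun h => hx (h ▸ hφ.mem x)⟩

omit [Fintype V] [DecidableEq V] in
theorem IsLinkSet.ne (hM : IsLinkSet G D φ M) {x y : V} (h : s(x, y) ∈ M) : x ≠ y :=
  SimpleGraph.Adj.ne (hM.sub _ h)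

omit [Fintype V] [DecidableEq V] in
theorem IsLinkSet.starTree_adj_link (hM : IsLinkSet G D φ M) {x y : V} (h : s(x, y) ∈ M) :
    (starTree φ M).Adj x y :=
  starTree_adj.2 ⟨Or.inr (Or.inr h), hM.ne h⟩

/-- If an edge with both ends outside the core covers a link, exchanging the two cannot enlarge the
core; hence both ends of the link are low. -/
theorem IsMaxLinkSet.isLow_of_long (hM : IsMaxLinkSet G D φ M) {x y z z' : V}
    (hxy : s(x, y) ∈ M) (h : Covers G (starTree φ M) x y z z') (hz : z ∉ core D M)
    (hz' : z' ∉ core D M) : IsLow D M x := by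
  by_contra hlow
  let M' := insert s(z, z') (M.erase s(x, y))
  have hdel : (starTree φ M).deleteEdges {s(x, y)} ≤ starTree φ M' := by
    intro a b hab
    rw [SimpleGraph.deleteEdges_adj, starTree_adj] at hab
    rw [starTree_adj]
    obtain ⟨⟨h1, h2⟩, h3⟩ := hab
    refine ⟨h1.imp_right (Or.imp_right fun h1 => ?_), h2⟩
    exact Finset.mem_insert_of_mem (Finset.mem_erase.2 ⟨fun h => h3 (by simpa using h), h1⟩)
  have hzz : (starTree φ M').Adj z z' :=
    starTree_adj.2 ⟨Or.inr (Or.inr (Finset.mem_insert_self _ _)), h.adj.ne⟩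
  have hM' : IsLinkSet G D φ M' := by
    refine ⟨fun e he => ?_, ?_, ?_⟩
    · rcases Finset.mem_insert.1 he with rfl | he
      exacts [h.adj, hM.1.sub e (Finset.mem_of_mem_erase he)]
    · have h1 : M'.card ≤ (M.erase s(x, y)).card + 1 := Finset.card_insert_le _ _
      have h2 := Finset.card_erase_add_one hxy
      have := hM.1.card
      omega
    · have := hM.1.conn.nonempty
      rw [SimpleGraph.connected_iff_exists_forall_reachable]
      refine ⟨x, fun a => ?_⟩
      rcases reachable_deleteEdges_or hM.1.conn x y a with ha | ha
      · exact ha.mono hdel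
      · exact (h.left.mono hdel).trans (hzz.reachable.trans
          ((h.right.mono hdel).symm.trans (ha.mono hdel)))
  have hsub : insert z (insert z' ((core D M).erase y)) ⊆ core D M' := by
    intro v hv
    simp only [Finset.mem_insert, Finset.mem_erase] at hv
    rw [mem_core]
    rcases hv with rfl | rfl | ⟨hvy, hv⟩
    · exact Or.inr ⟨_, Finset.mem_insert_self _ _, by simp⟩
    · exact Or.inr ⟨_, Finset.mem_insert_self _ _, by simp⟩
    · rcases mem_core.1 hv with hv | ⟨e, he, hve⟩
      · exact Or.inl hv
      · by_cases hexy : e = s(x, y)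
        · subst hexy
          obtain rfl : v = x := (Sym2.mem_iff.1 hve).resolve_right hvy
          by_cases hvD : v ∈ D
          · exact Or.inl hvD
          · -- `v` has a second link
            have h1 : (M.filter (v ∈ ·)).card ≠ 1 := fun h1 => hlow ⟨hvD, h1⟩
            have h2 : s(v, y) ∈ M.filter (v ∈ ·) := Finset.mem_filter.2 ⟨he, hve⟩
            have h3 : 1 < (M.filter (v ∈ ·)).card := by
              have := Finset.card_pos.2 ⟨_, h2⟩
              omega
            obtain ⟨e', he', hne⟩ := Finset.exists_mem_ne h3 s(v, y)
            rw [Finset.mem_filter] at he'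
            exact Or.inr ⟨e', Finset.mem_insert_of_mem (Finset.mem_erase.2 ⟨hne, he'.1⟩), he'.2⟩
        · exact Or.inr ⟨e, Finset.mem_insert_of_mem (Finset.mem_erase.2 ⟨hexy, he⟩), hve⟩
  have h1 := (Finset.card_le_card hsub).trans (hM.2 M' hM')
  have hy : y ∈ core D M := mem_core_left (Sym2.eq_swap ▸ hxy)
  rw [Finset.card_insert_of_notMem, Finset.card_insert_of_notMem] at h1
  · have := Finset.card_erase_add_one hy
    omega
  · exact fun h => hz' (Finset.mem_of_mem_erase h)
  · rw [Finset.mem_insert]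
    rintro (h2 | h2)
    exacts [h.adj.ne h2, hz (Finset.mem_of_mem_erase h2)]

/-- An edge with both ends outside the core that covers the star edge of a core vertex `x` also
covers a link at `x`. -/
theorem IsMaxLinkSet.exists_link_of_long (hφ : IsHomeMap G D φ) (hM : IsMaxLinkSet G D φ M)
    {x z z' : V} (hx : x ∉ D) (hxC : x ∈ core D M) (h : Covers G (starTree φ M) x (φ x) z z')
    (hz : z ∉ core D M) :
    ∃ y, s(x, y) ∈ M ∧ Covers G (starTree φ M) x y z' z := by
  obtain ⟨y, hy, hc⟩ := h.exists_adjacent (hM.1.isTree hφ) (by rintro rfl; exact hz hxC)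
  exact ⟨y, (hφ.eq_or_mem_of_adj hx hc.tree).resolve_left hy, hc.symm⟩

/-- A link whose ends are not both low has a covering ear with at most two edges. -/
theorem IsMaxLinkSet.exists_short_ear_link (hG : IsBridgeless G) (hφ : IsHomeMap G D φ)
    (hM : IsMaxLinkSet G D φ M) {x y : V} (hxy : s(x, y) ∈ M)
    (h : ¬ (IsLow D M x ∧ IsLow D M y)) :
    ∃ z z', Covers G (starTree φ M) x y z z' ∧ (z ∈ core D M ∨ z' ∈ core D M) := by
  obtain ⟨z, z', hc⟩ := exists_covers hG (hM.1.le hφ) (hM.1.isTree hφ)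
    (hM.1.starTree_adj_link hxy)
  refine ⟨z, z', hc, ?_⟩
  by_contra! hz
  exact h ⟨hM.isLow_of_long hxy hc hz.1 hz.2,
    hM.isLow_of_long (Sym2.eq_swap ▸ hxy) hc.symm hz.2 hz.1⟩

/-- The star edge of a core vertex that is not an end of a link between low vertices has a covering
ear with at most two edges. -/
theorem IsMaxLinkSet.exists_short_ear_star (hG : IsBridgeless G) (hφ : IsHomeMap G D φ)
    (hM : IsMaxLinkSet G D φ M) {x : V} (hx : x ∉ D) (hxC : x ∈ core D M)
    (h : ∀ y, s(x, y) ∈ M → ¬ (IsLow D M x ∧ IsLow D M y)) :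
    ∃ z z', Covers G (starTree φ M) x (φ x) z z' ∧ (z ∈ core D M ∨ z' ∈ core D M) := by
  obtain ⟨z, z', hc⟩ := exists_covers hG (hM.1.le hφ) (hM.1.isTree hφ)
    (hφ.starTree_adj_home hx)
  refine ⟨z, z', hc, ?_⟩
  by_contra! hz
  obtain ⟨y, hy, hc'⟩ := hM.exists_link_of_long hφ hx hxC hc hz.1
  exact h y hy ⟨hM.isLow_of_long hy hc' hz.2 hz.1,
    hM.isLow_of_long (Sym2.eq_swap ▸ hy) hc'.symm hz.1 hz.2⟩

/-- If every edge of `E` has a covering ear of at most two edges, and two edges of `E` share such an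
ear, then one ear can be saved. -/
theorem exists_secures_of_shared {E : Finset (Sym2 V)}
    (hE : ∀ f ∈ E, ∃ R, R.card ≤ 2 ∧ HasEar G D φ M f R) {f₁ f₂ : Sym2 V} (h₁ : f₁ ∈ E)
    (h₂ : f₂ ∈ E) (hne : f₁ ≠ f₂) {R : Finset (Sym2 V)} (hR : R.card ≤ 2)
    (hR₁ : HasEar G D φ M f₁ R) (hR₂ : HasEar G D φ M f₂ R) :
    ∃ K : Finset (Sym2 V), K.card + 2 ≤ 3 * E.card ∧ ∀ f ∈ E, Secures G D φ M K f := by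
  choose! S hS using hE
  let E' := (E.erase f₁).erase f₂
  refine ⟨E ∪ R ∪ E'.biUnion S, ?_, fun f hf => ⟨by simp [hf], ?_⟩⟩
  · have h1 : (E'.biUnion S).card ≤ E'.card * 2 := by
      refine Finset.card_biUnion_le_card_mul _ _ _ fun f hf => (hS f ?_).1
      exact Finset.mem_of_mem_erase (Finset.mem_of_mem_erase hf)
    have h2 : E'.card + 1 = (E.erase f₁).card :=
      Finset.card_erase_add_one (Finset.mem_erase.2 ⟨hne.symm, h₂⟩)
    have h3 := Finset.card_erase_add_one h₁
    have h4 := Finset.card_union_le (E ∪ R) (E'.biUnion S)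
    have h5 := Finset.card_union_le E R
    omega
  · by_cases hf1 : f = f₁
    · subst hf1
      exact ⟨R, fun e he => by simp [he], hR₁⟩
    by_cases hf2 : f = f₂
    · subst hf2
      exact ⟨R, fun e he => by simp [he], hR₂⟩
    have hf' : f ∈ E' := Finset.mem_erase.2 ⟨hf2, Finset.mem_erase.2 ⟨hf1, hf⟩⟩
    exact ⟨S f, (Finset.subset_biUnion_of_mem S hf').trans Finset.subset_union_right, (hS f hf).2⟩

theorem exists_secures_of_short {x y z z' : V} (hc : Covers G (starTree φ M) x y z z')
    (hz : z ∈ core D M ∨ z' ∈ core D M) :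
    ∃ K : Finset (Sym2 V), K.card ≤ 3 ∧ Secures G D φ M K s(x, y) := by
  refine ⟨insert s(x, y) (earEdges φ (core D M) s(z, z')), ?_, Finset.mem_insert_self _ _,
    _, Finset.subset_insert _ _, x, y, z, z', rfl, hc, rfl⟩
  exact (Finset.card_insert_le _ _).trans (Nat.succ_le_succ (card_earEdges_le_two φ _ hz))

/-- A covering edge of the only link at a low vertex `x` that does not end at `x` covers the star
edge of `x`. -/
theorem IsMaxLinkSet.covers_star (hφ : IsHomeMap G D φ) (hM : IsMaxLinkSet G D φ M) {x y z z' : V}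
    (hxy : s(x, y) ∈ M) (hx : IsLow D M x) (hc : Covers G (starTree φ M) x y z z') (hz : z ≠ x) :
    Covers G (starTree φ M) x (φ x) z' z := by
  obtain ⟨y₁, hy₁, hc₁⟩ := hc.exists_adjacent (hM.1.isTree hφ) hz
  rcases hφ.eq_or_mem_of_adj hx.1 hc₁.tree with rfl | h
  · exact hc₁.symm
  · exact absurd (hx.other_eq hxy h) hy₁

omit [Fintype V] [DecidableEq V] in
theorem IsLinkSet.star_ne (hφ : IsHomeMap G D φ) {x y : V} (hy : y ∉ D) :
    s(x, φ x) ≠ s(x, y) := by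
  intro h
  exact hy (Sym2.congr_right.1 h ▸ hφ.mem x)

/-- A link between low vertices and the two star edges at its ends are secured by seven edges. -/
theorem IsMaxLinkSet.exists_secures_low_low (hG : IsBridgeless G) (hφ : IsHomeMap G D φ)
    (hM : IsMaxLinkSet G D φ M) {x y : V} (hxy : s(x, y) ∈ M) (hx : IsLow D M x)
    (hy : IsLow D M y) :
    ∃ K : Finset (Sym2 V), K.card ≤ 7 ∧ Secures G D φ M K s(x, y) ∧
      Secures G D φ M K s(x, φ x) ∧ Secures G D φ M K s(y, φ y) := by
  have hyx : s(y, x) ∈ M := Sym2.eq_swap ▸ hxy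
  have hxC : x ∈ core D M := mem_core_left hxy
  have hyC : y ∈ core D M := mem_core_left hyx
  let E : Finset (Sym2 V) := {s(x, y), s(x, φ x), s(y, φ y)}
  have hEc : E.card ≤ 3 := Finset.card_le_three
  by_cases hlong : ∃ z z', Covers G (starTree φ M) x y z z' ∧ z ∉ core D M ∧ z' ∉ core D M
  · -- one ear of three edges secures all of them
    obtain ⟨z, z', hc, hz, hz'⟩ := hlong
    have h1 := hM.covers_star hφ hxy hx hc (by rintro rfl; exact hz hxC)
    have h2 := hM.covers_star hφ hyx hy hc.symm (by rintro rfl; exact hz' hyC)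
    let R := earEdges φ (core D M) s(z, z')
    refine ⟨E ∪ R, ?_, ⟨by simp [E], R, Finset.subset_union_right, x, y, z, z', rfl, hc, rfl⟩,
      ⟨by simp [E], R, Finset.subset_union_right, φ x, x, z, z', Sym2.eq_swap, h1.symm, rfl⟩,
      ⟨by simp [E], R, Finset.subset_union_right, y, φ y, z, z', rfl, h2, rfl⟩⟩
    have h3 := Finset.card_union_le E R
    have h4 : R.card ≤ 3 := card_earEdges_le φ _ z z'
    omega
  · -- otherwise a covering edge of the link also covers one of the star edges
    push Not at hlong
    have hshort : ∀ {z z'}, Covers G (starTree φ M) x y z z' → z ∈ core D M ∨ z' ∈ core D M :=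
      fun hc => or_iff_not_imp_left.2 (hlong _ _ hc)
    have hstar : ∀ {u v}, s(u, v) ∈ M → IsLow D M u →
        (∀ {z z'}, Covers G (starTree φ M) u v z z' → z ∈ core D M ∨ z' ∈ core D M) →
        ∃ R : Finset (Sym2 V), R.card ≤ 2 ∧ HasEar G D φ M s(u, φ u) R := by
      intro u v huv hu hs
      obtain ⟨z, z', hc⟩ := exists_covers hG (hM.1.le hφ) (hM.1.isTree hφ)
        (hφ.starTree_adj_home (M := M) hu.1)
      refine ⟨_, card_earEdges_le_two φ (core D M) (z := z) (z' := z') ?_, u, φ u, z, z', rfl, hc,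
        rfl⟩
      by_contra! hz
      obtain ⟨v', hv', hc'⟩ := hM.exists_link_of_long hφ hu.1 (mem_core_left huv) hc hz.1
      obtain rfl := hu.other_eq huv hv'
      rcases hs hc' with h | h
      exacts [hz.2 h, hz.1 h]
    have hsy := hstar hyx hy (fun hc => (hshort hc.symm).symm)
    have hsx := hstar hxy hx hshort
    obtain ⟨z, z', hc⟩ := exists_covers hG (hM.1.le hφ) (hM.1.isTree hφ)
      (hM.1.starTree_adj_link hxy)
    have hR := card_earEdges_le_two φ _ (hshort hc)
    have hear : HasEar G D φ M s(x, y) (earEdges φ (core D M) s(z, z')) :=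
      ⟨x, y, z, z', rfl, hc, rfl⟩
    have hE : ∀ f ∈ E, ∃ R : Finset (Sym2 V), R.card ≤ 2 ∧ HasEar G D φ M f R := by
      intro f hf
      simp only [E, Finset.mem_insert, Finset.mem_singleton] at hf
      rcases hf with rfl | rfl | rfl
      exacts [⟨_, hR, hear⟩, hsx, hsy]
    have hfin : ∃ K : Finset (Sym2 V), K.card + 2 ≤ 3 * E.card ∧
        ∀ f ∈ E, Secures G D φ M K f := by
      by_cases hzx : z = x
      · have hzy : z' ≠ y := by rintro rfl; exact hc.ne (by rw [hzx])
        have h1 := hM.covers_star hφ hyx hy hc.symm hzy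
        refine exists_secures_of_shared hE (f₁ := s(x, y)) (f₂ := s(y, φ y)) (by simp [E])
          (by simp [E]) ?_ hR hear ⟨y, φ y, z, z', rfl, h1, rfl⟩
        rw [Sym2.eq_swap]
        exact (IsLinkSet.star_ne hφ hx.1).symm
      · have h1 := hM.covers_star hφ hxy hx hc hzx
        exact exists_secures_of_shared hE (f₁ := s(x, y)) (f₂ := s(x, φ x)) (by simp [E])
          (by simp [E]) (IsLinkSet.star_ne hφ hy.1).symm hR hear
          ⟨φ x, x, z, z', Sym2.eq_swap, h1.symm, rfl⟩
    obtain ⟨K, hK, hKE⟩ := hfin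
    exact ⟨K, by omega, hKE _ (by simp [E]), hKE _ (by simp [E]), hKE _ (by simp [E])⟩

/-- The two links at a special vertex and the star edges at their ends are secured by `13` edges. -/
theorem IsMaxLinkSet.exists_secures_special (hG : IsBridgeless G) (hφ : IsHomeMap G D φ)
    (hM : IsMaxLinkSet G D φ M) {x : V} (hx : IsSpecial D M x) :
    ∃ K : Finset (Sym2 V), K.card ≤ 13 ∧ Secures G D φ M K s(x, φ x) ∧
      ∀ y, s(x, y) ∈ M → Secures G D φ M K s(x, y) ∧ Secures G D φ M K s(y, φ y) := by
  obtain ⟨hxD, hdeg, hlow⟩ := hx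
  have hxlow : ¬ IsLow D M x := fun h => by have := h.2; omega
  obtain ⟨e, e', hne, hee⟩ := Finset.card_eq_two.1 hdeg
  have hmem : ∀ e'', e'' ∈ M ∧ x ∈ e'' ↔ e'' = e ∨ e'' = e' := by
    intro e''
    simpa using Finset.ext_iff.1 hee e''
  obtain ⟨he, y, rfl⟩ := (hmem e).2 (Or.inl rfl)
  obtain ⟨he', y', rfl⟩ := (hmem e').2 (Or.inr rfl)
  have hyy : y' ≠ y := by rintro rfl; exact hne rfl
  have hyl : IsLow D M y := hlow _ he (by simp) y (by simp) (hM.1.ne he).symm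
  have hyl' : IsLow D M y' := hlow _ he' (by simp) y' (by simp) (hM.1.ne he').symm
  let E : Finset (Sym2 V) := {s(x, y), s(x, y'), s(x, φ x), s(y, φ y), s(y', φ y')}
  have hEc : E.card ≤ 5 := Finset.card_le_five
  have hstar : ∀ {u}, s(x, u) ∈ M → IsLow D M u →
      ∃ R : Finset (Sym2 V), R.card ≤ 2 ∧ HasEar G D φ M s(u, φ u) R := by
    intro u hu hul
    have hux : s(u, x) ∈ M := Sym2.eq_swap ▸ hu
    obtain ⟨z, z', hc, hz⟩ := hM.exists_short_ear_star hG hφ hul.1 (mem_core_left hux) (by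
      rintro v hv ⟨-, h⟩
      rw [hul.other_eq hux hv] at h
      exact hxlow h)
    exact ⟨_, card_earEdges_le_two φ _ hz, u, φ u, z, z', rfl, hc, rfl⟩
  obtain ⟨z, z', hc, hz⟩ := hM.exists_short_ear_link hG hφ he (fun h => hxlow h.1)
  have hR := card_earEdges_le_two φ _ hz
  have hear : HasEar G D φ M s(x, y) (earEdges φ (core D M) s(z, z')) :=
    ⟨x, y, z, z', rfl, hc, rfl⟩
  have hE : ∀ f ∈ E, ∃ R : Finset (Sym2 V), R.card ≤ 2 ∧ HasEar G D φ M f R := by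
    intro f hf
    simp only [E, Finset.mem_insert, Finset.mem_singleton] at hf
    rcases hf with rfl | rfl | rfl | rfl | rfl
    · exact ⟨_, hR, hear⟩
    · obtain ⟨w, w', hc', hw⟩ := hM.exists_short_ear_link hG hφ he' (fun h => hxlow h.1)
      exact ⟨_, card_earEdges_le_two φ _ hw, x, y', w, w', rfl, hc', rfl⟩
    · obtain ⟨w, w', hc', hw⟩ := hM.exists_short_ear_star hG hφ hxD (mem_core_left he)
        (fun _ _ h => hxlow h.1)
      exact ⟨_, card_earEdges_le_two φ _ hw, x, φ x, w, w', rfl, hc', rfl⟩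
    · exact hstar he hyl
    · exact hstar he' hyl'
  have hfin : ∃ K : Finset (Sym2 V), K.card + 2 ≤ 3 * E.card ∧
      ∀ f ∈ E, Secures G D φ M K f := by
    by_cases hzy : z' = y
    · have hzx : z ≠ x := by rintro rfl; exact hc.ne (by rw [hzy])
      obtain ⟨y₁, hy₁, hc₁⟩ := hc.exists_adjacent (hM.1.isTree hφ) hzx
      have hmem₁ : s(x, y₁) ∈ E := by
        rcases hφ.eq_or_mem_of_adj hxD hc₁.tree with rfl | h
        · simp [E]
        · rcases (hmem s(x, y₁)).1 ⟨h, by simp⟩ with h | h <;> rw [h] <;> simp [E]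
      exact exists_secures_of_shared hE (f₁ := s(x, y)) (f₂ := s(x, y₁)) (by simp [E]) hmem₁
        (fun h => hy₁ (Sym2.congr_right.1 h).symm) hR hear ⟨y₁, x, z, z', Sym2.eq_swap, hc₁, rfl⟩
    · have h1 := hM.covers_star hφ (Sym2.eq_swap ▸ he) hyl hc.symm hzy
      refine exists_secures_of_shared hE (f₁ := s(x, y)) (f₂ := s(y, φ y)) (by simp [E])
          (by simp [E]) ?_ hR hear ⟨y, φ y, z, z', rfl, h1, rfl⟩
      rw [Sym2.eq_swap]
      exact (IsLinkSet.star_ne hφ hxD).symm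
  obtain ⟨K, hK, hKE⟩ := hfin
  refine ⟨K, by omega, hKE _ (by simp [E]), fun u hu => ?_⟩
  rcases (hmem s(x, u)).1 ⟨hu, by simp⟩ with h | h
  · obtain rfl := Sym2.congr_right.1 h
    exact ⟨hKE _ (by simp [E]), hKE _ (by simp [E])⟩
  · obtain rfl := Sym2.congr_right.1 h
    exact ⟨hKE _ (by simp [E]), hKE _ (by simp [E])⟩


/-! ### Counting seven edges per link -/

open Classical in
/-- The number of edges spent at the link `e`. -/
noncomputable def linkCost (D : Finset V) (M : Finset (Sym2 V)) (e : Sym2 V) : ℕ :=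
  if ∀ v ∈ e, IsLow D M v then 7 else if ∃ v ∈ e, IsSpecial D M v then 0 else 3

open Classical in
/-- The number of edges spent at the vertex `v`. The star edge of a low vertex whose link leads to
a low or a special vertex is paid for there. -/
noncomputable def vertexCost (D : Finset V) (M : Finset (Sym2 V)) (v : V) : ℕ :=
  if v ∈ D ∨ linkDegree M v = 0 then 0
  else if IsLow D M v then
    if ∃ e ∈ M, v ∈ e ∧ ∃ w ∈ e, w ≠ v ∧ (IsLow D M w ∨ IsSpecial D M w) then 0 else 3
  else if IsSpecial D M v then 13 else 3

open Classical in
/-- The part of the budget of the link `e` that is handed to its end `v`. -/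
noncomputable def share (D : Finset V) (M : Finset (Sym2 V)) (e : Sym2 V) (v : V) : ℕ :=
  if IsLow D M v then
    if ∃ w ∈ e, w ≠ v ∧ (IsLow D M w ∨ IsSpecial D M w) then 0 else 3
  else if IsSpecial D M v then 7
  else if ∃ w ∈ e, w ≠ v ∧ IsLow D M w then 1 else 2

omit [Fintype V] in
theorem IsSpecial.not_isLow {v : V} (h : IsSpecial D M v) : ¬ IsLow D M v :=
  fun h' => by have h1 := h'.2; have h2 := h.2.1; omega

/-- A link never spends more than its budget of seven edges. -/
theorem linkCost_add_share_le {e : Sym2 V} (he : e ∈ M) (hd : ¬ e.IsDiag) :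
    linkCost D M e + ∑ v ∈ e.toFinset, share D M e v ≤ 7 := by
  induction e with
  | h x y =>
    have hxy : x ≠ y := by simpa using hd
    have hsx : IsSpecial D M x → IsLow D M y ∧ ¬ IsLow D M x :=
      fun h => ⟨h.2.2 _ he (by simp) y (by simp) hxy.symm, h.not_isLow⟩
    have hsy : IsSpecial D M y → IsLow D M x ∧ ¬ IsLow D M y :=
      fun h => ⟨h.2.2 _ he (by simp) x (by simp) hxy, h.not_isLow⟩
    rw [Sym2.toFinset_mk_eq, Finset.sum_pair hxy]
    simp only [linkCost, share]
    by_cases hx : IsLow D M x <;> by_cases hy : IsLow D M y <;> by_cases sx : IsSpecial D M x <;>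
      by_cases sy : IsSpecial D M y <;> simp [hx, hy, sx, sy, hxy, hxy.symm] <;> tauto

/-- The shares that a vertex receives pay for its edges. The tight case is a vertex with two links
that is not special: one of its links does not lead to a low vertex and hands it two edges. -/
theorem vertexCost_le_sum_share (v : V) :
    vertexCost D M v ≤ ∑ e ∈ M.filter (v ∈ ·), share D M e v := by
  unfold vertexCost
  split_ifs with h1 h2 h3 h4
  · exact Nat.zero_le _
  · exact Nat.zero_le _
  · obtain ⟨e, he⟩ := Finset.card_eq_one.1 h2.2
    have hem : e ∈ M ∧ v ∈ e := by
      rw [← Finset.mem_filter (p := (v ∈ ·)), he]; simp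
    rw [he, Finset.sum_singleton, share, if_pos h2, if_neg]
    exact fun h => h3 ⟨e, hem.1, hem.2, h⟩
  · have h5 : ∑ e ∈ M.filter (v ∈ ·), share D M e v = ∑ e ∈ M.filter (v ∈ ·), 7 :=
      Finset.sum_congr rfl fun e _ => by rw [share, if_neg h2, if_pos h4]
    have h6 : (M.filter (v ∈ ·)).card = 2 := h4.2.1
    rw [h5, Finset.sum_const, h6]
    norm_num
  · push Not at h1
    classical
    have hs : ∀ e, share D M e v = if ∃ w ∈ e, w ≠ v ∧ IsLow D M w then 1 else 2 :=
      fun e => by rw [share, if_neg h2, if_neg h4]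
    have hge : ∀ e, 1 ≤ share D M e v := fun e => by rw [hs]; split_ifs <;> norm_num
    have hcard : (M.filter (v ∈ ·)).card ≠ 0 := h1.2
    have hcard1 : (M.filter (v ∈ ·)).card ≠ 1 := fun h => h2 ⟨h1.1, h⟩
    by_cases hcard2 : (M.filter (v ∈ ·)).card = 2
    · -- one of the two links does not lead to a low vertex
      have h5 : ∃ e ∈ M.filter (v ∈ ·), share D M e v = 2 := by
        by_contra! hcon
        refine h4 ⟨h1.1, hcard2, fun e he hve w hwe hwv => ?_⟩
        have h6 := hcon e (Finset.mem_filter.2 ⟨he, hve⟩)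
        rw [hs] at h6
        obtain ⟨w', hw'e, hw'v, hw'⟩ : ∃ w ∈ e, w ≠ v ∧ IsLow D M w := by
          by_contra h
          exact h6 (if_neg h)
        obtain ⟨u, rfl⟩ := hve
        have h7 : w = u := (Sym2.mem_iff.1 hwe).resolve_left hwv
        have h8 : w' = u := (Sym2.mem_iff.1 hw'e).resolve_left hw'v
        rwa [h7, ← h8]
      obtain ⟨e, he, hse⟩ := h5
      rw [← Finset.add_sum_erase _ _ he, hse]
      have h6 : 1 < (M.filter (v ∈ ·)).card := by omega
      obtain ⟨e', he', hne⟩ := Finset.exists_mem_ne h6 e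
      have h7 := Finset.single_le_sum (f := fun e => share D M e v) (fun _ _ => Nat.zero_le _)
        (Finset.mem_erase.2 ⟨hne, he'⟩)
      have := hge e'
      omega
    · have h5 := Finset.card_nsmul_le_sum (M.filter (v ∈ ·)) (fun e => share D M e v) 1
        (fun e _ => hge e)
      simp only [smul_eq_mul, mul_one] at h5
      omega

theorem sum_cost_le (hd : ∀ e ∈ M, ¬ e.IsDiag) :
    ∑ e ∈ M, linkCost D M e + ∑ v, vertexCost D M v ≤ 7 * M.card := by
  have h1 : ∑ v, vertexCost D M v ≤ ∑ e ∈ M, ∑ v ∈ e.toFinset, share D M e v := by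
    rw [Finset.sum_comm' (t' := Finset.univ) (s' := fun v => M.filter (v ∈ ·))]
    · exact Finset.sum_le_sum fun v _ => vertexCost_le_sum_share v
    · intro e v
      simp [Sym2.mem_toFinset]
  calc _ ≤ ∑ e ∈ M, (linkCost D M e + ∑ v ∈ e.toFinset, share D M e v) := by
        rw [Finset.sum_add_distrib]; exact Nat.add_le_add_left h1 _
    _ ≤ ∑ e ∈ M, 7 := Finset.sum_le_sum fun e he => linkCost_add_share_le he (hd e he)
    _ = 7 * M.card := by rw [Finset.sum_const, smul_eq_mul, mul_comm]

/-- With seven edges for each link, all edges of the pruned tree are secured. -/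
theorem IsMaxLinkSet.exists_secures (hG : IsBridgeless G) (hφ : IsHomeMap G D φ)
    (hM : IsMaxLinkSet G D φ M) :
    ∃ K : Finset (Sym2 V), K.card ≤ 7 * M.card ∧ (∀ e ∈ M, Secures G D φ M K e) ∧
      ∀ x ∈ core D M, x ∉ D → Secures G D φ M K s(x, φ x) := by
  have hlink : ∀ e ∈ M, ∃ K : Finset (Sym2 V), K.card ≤ linkCost D M e ∧
      ((∀ v ∈ e, IsLow D M v) → Secures G D φ M K e ∧ ∀ v ∈ e, Secures G D φ M K s(v, φ v)) ∧
      ((¬ ∃ v ∈ e, IsSpecial D M v) → Secures G D φ M K e) := by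
    intro e he
    induction e with
    | h x y =>
      by_cases hlow : ∀ v ∈ s(x, y), IsLow D M v
      · obtain ⟨K, hK, h1, h2, h3⟩ := hM.exists_secures_low_low hG hφ he (hlow x (by simp))
          (hlow y (by simp))
        refine ⟨K, by rwa [linkCost, if_pos hlow], fun _ => ⟨h1, ?_⟩, fun _ => h1⟩
        simpa using ⟨h2, h3⟩
      · by_cases hs : ∃ v ∈ s(x, y), IsSpecial D M v
        · exact ⟨∅, by simp, fun h => absurd h hlow, fun h => absurd hs h⟩
        · obtain ⟨z, z', hc, hz⟩ := hM.exists_short_ear_link hG hφ he (by simpa using hlow)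
          obtain ⟨K, hK, h1⟩ := exists_secures_of_short hc hz
          exact ⟨K, by rwa [linkCost, if_neg hlow, if_neg hs], fun h => absurd h hlow, fun _ => h1⟩
  have hvertex : ∀ x, ∃ K : Finset (Sym2 V), K.card ≤ vertexCost D M x ∧
      (IsSpecial D M x → Secures G D φ M K s(x, φ x) ∧
        ∀ y, s(x, y) ∈ M → Secures G D φ M K s(x, y) ∧ Secures G D φ M K s(y, φ y)) ∧
      (x ∈ core D M → x ∉ D →
        (¬ ∃ e ∈ M, x ∈ e ∧ IsLow D M x ∧ ∃ w ∈ e, w ≠ x ∧ (IsLow D M w ∨ IsSpecial D M w)) →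
        Secures G D φ M K s(x, φ x)) := by
    intro x
    have hdeg : x ∈ core D M → x ∉ D → linkDegree M x ≠ 0 := by
      intro hx hxD
      obtain ⟨e, he, hxe⟩ := (mem_core.1 hx).resolve_left hxD
      exact (Finset.card_pos.2 ⟨e, Finset.mem_filter.2 ⟨he, hxe⟩⟩).ne'
    by_cases hs : IsSpecial D M x
    · obtain ⟨K, hK, h1, h2⟩ := hM.exists_secures_special hG hφ hs
      refine ⟨K, ?_, fun _ => ⟨h1, h2⟩, fun _ _ _ => h1⟩
      have h3 : linkDegree M x ≠ 0 := by have := hs.2.1; omega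
      rwa [vertexCost, if_neg (by simp [hs.1, h3]), if_neg hs.not_isLow, if_pos hs]
    by_cases hsec : x ∈ core D M ∧ x ∉ D ∧
        ¬ ∃ e ∈ M, x ∈ e ∧ IsLow D M x ∧ ∃ w ∈ e, w ≠ x ∧ (IsLow D M w ∨ IsSpecial D M w)
    · obtain ⟨hxC, hxD, hn⟩ := hsec
      obtain ⟨z, z', hc, hz⟩ := hM.exists_short_ear_star hG hφ hxD hxC (by
        rintro y hy ⟨hl, hl'⟩
        exact hn ⟨_, hy, by simp, hl, y, by simp, (hM.1.ne hy).symm, Or.inl hl'⟩)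
      obtain ⟨K, hK, h1⟩ := exists_secures_of_short hc hz
      refine ⟨K, ?_, fun h => absurd h hs, fun _ _ _ => h1⟩
      rw [vertexCost, if_neg (by simp [hxD, hdeg hxC hxD])]
      split_ifs with h2 h3
      · obtain ⟨e, he, hxe, hw⟩ := h3
        exact absurd ⟨e, he, hxe, h2, hw⟩ hn
      · exact hK
      · exact hK
    · exact ⟨∅, by simp, fun h => absurd h hs, fun h1 h2 h3 => absurd ⟨h1, h2, h3⟩ hsec⟩
  choose! KL hKL using hlink
  choose KV hKV using hvertex
  let K := M.biUnion KL ∪ Finset.univ.biUnion KV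
  have hL : ∀ e ∈ M, KL e ⊆ K := fun e he =>
    (Finset.subset_biUnion_of_mem KL he).trans Finset.subset_union_left
  have hV : ∀ x, KV x ⊆ K := fun x =>
    (Finset.subset_biUnion_of_mem KV (Finset.mem_univ x)).trans Finset.subset_union_right
  have hother : ∀ {e : Sym2 V} {x w : V}, x ∈ e → w ∈ e → w ≠ x → e = s(w, x) := by
    intro e x w hx hw hne
    exact (Sym2.mem_and_mem_iff hne).1 ⟨hw, hx⟩
  refine ⟨K, ?_, ?_, ?_⟩
  · calc K.card ≤ (M.biUnion KL).card + (Finset.univ.biUnion KV).card := Finset.card_union_le _ _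
      _ ≤ ∑ e ∈ M, linkCost D M e + ∑ v, vertexCost D M v := by
        refine Nat.add_le_add (Finset.card_biUnion_le.trans ?_) (Finset.card_biUnion_le.trans ?_)
        · exact Finset.sum_le_sum fun e he => (hKL e he).1
        · exact Finset.sum_le_sum fun v _ => (hKV v).1
      _ ≤ 7 * M.card := sum_cost_le fun e he => G.not_isDiag_of_mem_edgeSet (hM.1.sub e he)
  · intro e he
    by_cases hs : ∃ v ∈ e, IsSpecial D M v
    · obtain ⟨v, ⟨w, rfl⟩, hv⟩ := hs
      exact (((hKV v).2.1 hv).2 w he).1.mono (hV v)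
    · exact ((hKL e he).2.2 hs).mono (hL e he)
  · intro x hxC hxD
    by_cases hn : ∃ e ∈ M, x ∈ e ∧ IsLow D M x ∧ ∃ w ∈ e, w ≠ x ∧ (IsLow D M w ∨ IsSpecial D M w)
    · obtain ⟨e, he, hxe, hx, w, hwe, hwx, hw | hw⟩ := hn
      · refine (((hKL e he).2.1 ?_).2 x hxe).mono (hL e he)
        intro v hv
        rw [hother hxe hwe hwx] at hv
        rcases Sym2.mem_iff.1 hv with rfl | rfl
        exacts [hw, hx]
      · rw [hother hxe hwe hwx] at he
        exact (((hKV w).2.1 hw).2 x he).2.mono (hV w)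
    · exact ((hKV x).2.2 hxC hxD hn).mono (hV x)

/-! ### A small strong part around a dominating set -/

/-- If `K` secures all edges of the pruned tree, then no removal of a single edge disconnects the
core inside `K`. -/
theorem IsLinkSet.reachable_deleteEdges (hφ : IsHomeMap G D φ) (hM : IsLinkSet G D φ M)
    {K : Finset (Sym2 V)} (hK : ∀ e ∈ M, Secures G D φ M K e)
    (hK' : ∀ x ∈ core D M, x ∉ D → Secures G D φ M K s(x, φ x)) (f : Sym2 V) {r d : V}
    (hr : r ∈ core D M) (hd : d ∈ core D M) :
    ((SimpleGraph.fromEdgeSet (K : Set (Sym2 V)) ⊓ G).deleteEdges {f}).Reachable r d := by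
  set H := SimpleGraph.fromEdgeSet (K : Set (Sym2 V)) ⊓ G with hH
  -- vertices outside the core are replaced by their homes
  let π : V → V := fun v => if v ∈ core D M then v else φ v
  have hπ : ∀ {v}, v ∈ core D M → π v = v := fun h => if_pos h
  have hπ' : ∀ {v}, v ∉ core D M → π v = φ v := fun h => if_neg h
  have hDC : ∀ {v}, v ∈ D → v ∈ core D M := fun h => mem_core.2 (Or.inl h)
  have hadj : ∀ {a b}, s(a, b) ∈ K → G.Adj a b → s(a, b) ≠ f → (H.deleteEdges {f}).Adj a b := by
    intro a b h1 h2 h3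
    rw [SimpleGraph.deleteEdges_adj, hH, SimpleGraph.inf_adj, SimpleGraph.fromEdgeSet_adj]
    exact ⟨⟨⟨h1, h2.ne⟩, h2⟩, by simpa using h3⟩
  have hstar : ∀ {a}, a ∉ D → s(a, φ a) ≠ f → (H.deleteEdges {f}).Reachable (π a) (π (φ a)) := by
    intro a ha hne
    rw [hπ (hDC (hφ.mem a))]
    by_cases haC : a ∈ core D M
    · rw [hπ haC]
      exact (hadj (hK' a haC ha).1 (hφ.adj a ha) hne).reachable
    · rw [hπ' haC]
  have hstep : ∀ {a b}, (starTree φ M).Adj a b → s(a, b) ≠ f →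
      (H.deleteEdges {f}).Reachable (π a) (π b) := by
    intro a b hab hne
    rw [starTree_adj] at hab
    obtain ⟨rfl | rfl | h, hab⟩ := hab
    · exact hstar (fun h => hab (hφ.fix a h).symm) hne
    · exact (hstar (fun h => hab (hφ.fix b h)) (by rwa [Sym2.eq_swap])).symm
    · rw [hπ (mem_core_left h), hπ (mem_core_left (Sym2.eq_swap ▸ h))]
      exact (hadj (hK _ h).1 (hM.sub _ h) hne).reachable
  have hpush : ∀ {a b}, ((starTree φ M).deleteEdges {f}).Reachable a b →
      (H.deleteEdges {f}).Reachable (π a) (π b) := by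
    rintro a b ⟨p⟩
    induction p with
    | nil => exact .rfl
    | cons h p ih =>
      rw [SimpleGraph.deleteEdges_adj] at h
      exact (hstep h.1 (by simpa using h.2)).trans ih
  have hsec : ∀ {x y}, f = s(x, y) → x ∈ core D M → y ∈ core D M → Secures G D φ M K f →
      (H.deleteEdges {f}).Reachable x y := by
    rintro x y hf hx hy ⟨-, R, hRK, x₀, y₀, z, z', hf₀, hc, rfl⟩
    have hx₀ : x₀ ∈ core D M ∧ y₀ ∈ core D M := by
      rcases Sym2.eq_iff.1 (hf.symm.trans hf₀) with ⟨rfl, rfl⟩ | ⟨rfl, rfl⟩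
      exacts [⟨hx, hy⟩, ⟨hy, hx⟩]
    have hend : ∀ v ∈ s(z, z'), (H.deleteEdges {f}).Reachable (π v) v := by
      intro v hv
      by_cases hvC : v ∈ core D M
      · rw [hπ hvC]
      · rw [hπ' hvC]
        refine (hadj (hRK ?_) (hφ.adj v fun h => hvC (hDC h)) ?_).reachable.symm
        · exact Finset.mem_insert_of_mem (Finset.mem_image.2 ⟨v, by simpa [hvC] using hv, rfl⟩)
        · intro h
          have h1 : v ∈ s(x₀, y₀) := by rw [← hf₀, ← h]; simp
          rcases Sym2.mem_iff.1 h1 with rfl | rfl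
          exacts [hvC hx₀.1, hvC hx₀.2]
    have hzz : (H.deleteEdges {f}).Reachable z z' :=
      (hadj (hRK (Finset.mem_insert_self _ _)) hc.adj (hf₀ ▸ hc.ne)).reachable
    have h1 := hpush (hf₀ ▸ hc.left)
    have h2 := hpush (hf₀ ▸ hc.right)
    rw [hπ hx₀.1] at h1
    rw [hπ hx₀.2] at h2
    have h3 : (H.deleteEdges {f}).Reachable x₀ y₀ :=
      (h1.trans (hend z (by simp))).trans (hzz.trans ((h2.trans (hend z' (by simp))).symm))
    rcases Sym2.eq_iff.1 (hf.symm.trans hf₀) with ⟨rfl, rfl⟩ | ⟨rfl, rfl⟩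
    exacts [h3, h3.symm]
  -- the two ends of `f` stay connected
  have hends : ∀ {x y}, f = s(x, y) → (starTree φ M).Adj x y →
      (H.deleteEdges {f}).Reachable (π x) (π y) := by
    have hs : ∀ {a}, a ∉ D → f = s(a, φ a) → (H.deleteEdges {f}).Reachable (π a) (π (φ a)) := by
      intro a ha hf
      rw [hπ (hDC (hφ.mem a))]
      by_cases haC : a ∈ core D M
      · rw [hπ haC]
        exact hsec hf haC (hDC (hφ.mem a)) (hf ▸ hK' a haC ha)
      · rw [hπ' haC]
    intro x y hf hxy
    rw [starTree_adj] at hxy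
    obtain ⟨rfl | rfl | h, hne⟩ := hxy
    · exact hs (fun h => hne (hφ.fix x h).symm) hf
    · exact (hs (fun h => hne (hφ.fix y h)) (by rw [hf, Sym2.eq_swap])).symm
    · rw [hπ (mem_core_left h), hπ (mem_core_left (Sym2.eq_swap ▸ h))]
      exact hsec hf (mem_core_left h) (mem_core_left (Sym2.eq_swap ▸ h)) (hf ▸ hK _ h)
  rw [← hπ hr, ← hπ hd]
  have hall : ∀ {a b}, (starTree φ M).Walk a b → (H.deleteEdges {f}).Reachable (π a) (π b) := by
    intro a b p
    induction p with
    | nil => exact .rfl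
    | @cons a b c h p ih =>
      refine SimpleGraph.Reachable.trans ?_ ih
      by_cases hf : s(a, b) = f
      exacts [hends hf.symm h, hstep h hf]
  obtain ⟨p⟩ := hM.conn.preconnected r d
  exact hall p

end

/-- A dominating set `D` of a connected bridgeless graph lies in a strongly oriented part with at
most `7 (|D| - 1)` arcs. -/
theorem exists_isStrongPart_of_isDominatingSet {V : Type*} [Fintype V] {G : SimpleGraph V} {D : Finset V}
    (hG : G.Connected) (hb : IsBridgeless G) {φ : V → V} (hφ : IsHomeMap G D φ) :
    ∃ W A, IsStrongPart G W A ∧ D ⊆ W ∧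
      Set.encard {p : V × V | A p.1 p.2} ≤ ((7 * (D.card - 1) : ℕ) : ℕ∞) := by
  classical
  let S : Finset (Finset (Sym2 V)) := Finset.univ.filter fun M => IsLinkSet G D φ M
  have hS : S.Nonempty := by
    obtain ⟨M, hM⟩ := exists_isLinkSet hG hφ
    exact ⟨M, by simpa [S] using hM⟩
  obtain ⟨M, hM, hmax⟩ := S.exists_max_image (fun M => (core D M).card) hS
  have hM' : IsMaxLinkSet G D φ M :=
    ⟨by simpa [S] using hM, fun M' h => hmax M' (by simpa [S] using h)⟩
  obtain ⟨K, hK, h1, h2⟩ := hM'.exists_secures hb hφ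
  obtain ⟨v₀⟩ := hG.nonempty
  have hDC : ∀ {v}, v ∈ D → v ∈ core D M := fun h => mem_core.2 (Or.inl h)
  obtain ⟨W, A, hA, -, hDW⟩ := exists_isStrongPart
    (SimpleGraph.fromEdgeSet (K : Set (Sym2 V)) ⊓ G) (φ v₀) D fun f d hd =>
      hM'.1.reachable_deleteEdges hφ h1 h2 f (hDC (hφ.mem v₀)) (hDC hd)
  refine ⟨W, A, ⟨fun h => (hA.adj h).2, hA.fst_mem, hA.snd_mem, hA.asymm, hA.strong⟩, hDW, ?_⟩
  have h3 : (SimpleGraph.fromEdgeSet (K : Set (Sym2 V)) ⊓ G).edgeSet ⊆ K := by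
    intro e he
    rw [SimpleGraph.edgeSet_inf, SimpleGraph.edgeSet_fromEdgeSet] at he
    exact he.1.1
  refine hA.encard_le.trans ((Set.encard_le_encard h3).trans ?_)
  rw [Set.encard_coe_eq_coe_finsetCard]
  have := hM'.1.card
  exact_mod_cast hK.trans (by omega)

/-! ### Orienting the remaining vertices -/

/-- A set `S` of vertices together with a set `E` of arcs of `P` that lead from `W` to each vertex
of `S` and back to `W`. -/
structure IsDirectedEar {V : Type*} (P : V → V → Prop) (W S : Finset V) (E : Finset (V × V)) :
    Prop where
  sub : ∀ a b, (a, b) ∈ E → P a b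
  fst_mem : ∀ a b, (a, b) ∈ E → a ∈ W ∨ a ∈ S
  snd_mem : ∀ a b, (a, b) ∈ E → b ∈ W ∨ b ∈ S
  from_base : ∀ a ∈ S, ∃ w ∈ W, Relation.ReflTransGen (fun x y => (x, y) ∈ E) w a
  to_base : ∀ a ∈ S, ∃ w ∈ W, Relation.ReflTransGen (fun x y => (x, y) ∈ E) a w

/-- Two vertices that lie in a strong part with `m` arcs, or on ears of this part with at most three
arcs, have strong distance at most `m + 6`. -/
theorem strongDist_le_of_ears {V : Type*} {K : SimpleGraph V} {W : Finset V} {A : V → V → Prop}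
    (hA : IsStrongPart K W A) {O : Digraph V} (hAO : ∀ a b, A a b → O.Adj a b) {m : ℕ}
    (hm : Set.encard {p : V × V | A p.1 p.2} ≤ m) {S₁ S₂ : Finset V} {E₁ E₂ : Finset (V × V)}
    (h₁ : IsDirectedEar O.Adj W S₁ E₁) (h₂ : IsDirectedEar O.Adj W S₂ E₂) (hE₁ : E₁.card ≤ 3)
    (hE₂ : E₂.card ≤ 3) {u v : V} (hu : u ∈ W ∨ u ∈ S₁) (hv : v ∈ W ∨ v ∈ S₂) :
    Relation.ReflTransGen O.Adj u v ∧ strongDist O u v ≤ ((m + 6 : ℕ) : ℕ∞) := by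
  let H : SubDigraph O :=
    { verts := {a | a ∈ W ∨ a ∈ S₁ ∨ a ∈ S₂}
      Adj := fun a b => A a b ∨ (a, b) ∈ E₁ ∨ (a, b) ∈ E₂
      adj_sub := by
        rintro a b (h | h | h)
        exacts [hAO _ _ h, h₁.sub _ _ h, h₂.sub _ _ h]
      fst_mem := by
        rintro a b (h | h | h)
        exacts [Or.inl (hA.fst_mem h), (h₁.fst_mem _ _ h).imp_right Or.inl,
          (h₂.fst_mem _ _ h).imp_right Or.inr]
      snd_mem := by
        rintro a b (h | h | h)
        exacts [Or.inl (hA.snd_mem h), (h₁.snd_mem _ _ h).imp_right Or.inl,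
          (h₂.snd_mem _ _ h).imp_right Or.inr] }
  have mA : ∀ {a b}, Relation.ReflTransGen A a b → Relation.ReflTransGen H.Adj a b :=
    Relation.ReflTransGen.mono (fun _ _ h => Or.inl h) _ _
  have m₁ : ∀ {a b}, Relation.ReflTransGen (fun x y => (x, y) ∈ E₁) a b →
      Relation.ReflTransGen H.Adj a b :=
    Relation.ReflTransGen.mono (fun _ _ h => Or.inr (Or.inl h)) _ _
  have m₂ : ∀ {a b}, Relation.ReflTransGen (fun x y => (x, y) ∈ E₂) a b →
      Relation.ReflTransGen H.Adj a b :=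
    Relation.ReflTransGen.mono (fun _ _ h => Or.inr (Or.inr h)) _ _
  have hto : ∀ a ∈ H.verts, ∃ w ∈ W, Relation.ReflTransGen H.Adj a w := by
    rintro a (h | h | h)
    · exact ⟨a, h, .refl⟩
    · obtain ⟨w, hw, h⟩ := h₁.to_base a h
      exact ⟨w, hw, m₁ h⟩
    · obtain ⟨w, hw, h⟩ := h₂.to_base a h
      exact ⟨w, hw, m₂ h⟩
  have hfrom : ∀ a ∈ H.verts, ∃ w ∈ W, Relation.ReflTransGen H.Adj w a := by
    rintro a (h | h | h)
    · exact ⟨a, h, .refl⟩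
    · obtain ⟨w, hw, h⟩ := h₁.from_base a h
      exact ⟨w, hw, m₁ h⟩
    · obtain ⟨w, hw, h⟩ := h₂.from_base a h
      exact ⟨w, hw, m₂ h⟩
  have hH : H.IsStrong := by
    intro a ha b hb
    obtain ⟨w, hw, h⟩ := hto a ha
    obtain ⟨w', hw', h'⟩ := hfrom b hb
    exact h.trans ((mA (hA.strong hw hw')).trans h')
  have huH : u ∈ H.verts := hu.imp_right Or.inl
  have hvH : v ∈ H.verts := hv.imp_right Or.inr
  refine ⟨Relation.ReflTransGen.mono (fun _ _ h => H.adj_sub h) _ _ (hH u huH v hvH), ?_⟩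
  refine (iInf₂_le H hH).trans ((iInf₂_le huH hvH).trans ?_)
  have h3 : {p : V × V | H.Adj p.1 p.2} ⊆ {p : V × V | A p.1 p.2} ∪ (E₁ ∪ E₂ : Set (V × V)) :=
    fun p hp => hp
  calc H.numArcs ≤ _ := Set.encard_le_encard h3
    _ ≤ m + (3 + 3) := by
      refine (Set.encard_union_le _ _).trans (add_le_add hm ((Set.encard_union_le _ _).trans ?_))
      rw [Set.encard_coe_eq_coe_finsetCard, Set.encard_coe_eq_coe_finsetCard]
      exact add_le_add (by exact_mod_cast hE₁) (by exact_mod_cast hE₂)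
    _ = ((m + 6 : ℕ) : ℕ∞) := by push_cast; norm_num

/-- An asymmetric relation whose arcs are edges of `G` extends to an orientation of `G`. -/
theorem exists_isOrientation_ge {V : Type*} [Finite V] {G : SimpleGraph V} {P : V → V → Prop}
    (hP : ∀ a b, P a b → G.Adj a b) (hP' : ∀ a b, P a b → ¬ P b a) :
    ∃ O : Digraph V, IsOrientation G O ∧ ∀ a b, P a b → O.Adj a b := by
  obtain ⟨n, ⟨f⟩⟩ := Finite.exists_equiv_fin V
  refine ⟨⟨fun a b => P a b ∨ (G.Adj a b ∧ ¬ P b a ∧ f a < f b)⟩, ⟨fun u v => ⟨fun h => ?_, ?_⟩,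
    ?_⟩, fun _ _ h => Or.inl h⟩
  · have hne : f u ≠ f v := fun h' => h.ne (f.injective h')
    have := h.symm
    rcases lt_or_gt_of_ne hne with hlt | hlt <;> by_cases h1 : P u v <;> by_cases h2 : P v u <;>
      simp [*]
  · rintro ((h | h) | (h | h))
    exacts [hP _ _ h, h.1, (hP _ _ h).symm, h.1.symm]
  · rintro u v (h | ⟨-, h1, h2⟩) (h' | ⟨-, h3, h4⟩)
    exacts [hP' _ _ h h', h3 h, h1 h', lt_asymm h2 h4]

/-- If every vertex of `N` has a neighbour in `N`, then a maximal independent set splits `N` into two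
classes such that each vertex has a neighbour in the other class. -/
theorem exists_split {V : Type*} [Finite V] (G : SimpleGraph V) (N : Set V)
    (hN : ∀ v ∈ N, ∃ u ∈ N, G.Adj v u) :
    ∃ X ⊆ N, (∀ v ∈ X, ∃ u ∈ N, u ∉ X ∧ G.Adj v u) ∧
      ∀ v ∈ N, v ∉ X → ∃ u ∈ X, G.Adj u v := by
  have hfin : {X : Set V | X ⊆ N ∧ ∀ u ∈ X, ∀ v ∈ X, ¬ G.Adj u v}.Finite := Set.toFinite _
  obtain ⟨X, hX⟩ := hfin.exists_maximal ⟨∅, by simp⟩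
  refine ⟨X, hX.prop.1, fun v hv => ?_, fun v hv hvX => ?_⟩
  · obtain ⟨u, hu, h⟩ := hN v (hX.prop.1 hv)
    exact ⟨u, hu, fun huX => hX.prop.2 v hv u huX h, h⟩
  · by_contra! hcon
    refine hvX (hX.le_of_ge (y := insert v X) ⟨Set.insert_subset hv hX.prop.1, ?_⟩
      (Set.subset_insert v X) (Set.mem_insert v X))
    rintro a (rfl | ha) b (rfl | hb) h
    exacts [h.ne rfl, hcon b hb h.symm, hcon a ha h, hX.prop.2 a ha b hb h]

/-- The upper bound: the vertices outside a small strong part around `D` lie on directed ears with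
at most three arcs. -/
theorem orientedStrongDiam_le_of_isDominatingSet {V : Type*} [Finite V] {G : SimpleGraph V}
    {D : Finset V} (hG : G.Connected) (hb : IsBridgeless G) (hD : IsDominatingSet G D) :
    orientedStrongDiam G ≤ ((7 * D.card - 1 : ℕ) : ℕ∞) := by
  classical
  have := Fintype.ofFinite V
  obtain ⟨φ, hφ⟩ := hD.exists_isHomeMap
  obtain ⟨W, A, hA, hDW, hm⟩ := exists_isStrongPart_of_isDominatingSet hG hb hφ
  have hφW : ∀ v, φ v ∈ W := fun v => hDW (hφ.mem v)
  have hφadj : ∀ v, v ∉ W → G.Adj v (φ v) := fun v hv => hφ.adj v fun h => hv (hDW h)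
  obtain ⟨X, hXN, hX, hY⟩ := exists_split G {v | v ∉ W ∧ ∃ u, u ∉ W ∧ G.Adj v u} (by
    rintro v ⟨hv, u, hu, h⟩
    exact ⟨u, ⟨hu, v, hv, h.symm⟩, h⟩)
  -- a vertex without neighbours outside `W` has a second neighbour in `W`
  have hsecond : ∀ v, (v ∉ W ∧ ∀ u, u ∉ W → ¬ G.Adj v u) → ∃ b ∈ W, b ≠ φ v ∧ G.Adj v b := by
    rintro v ⟨hv, hiso⟩
    have h1 := hb s(v, φ v) (hφadj v hv)
    rw [SimpleGraph.isBridge_iff, not_not] at h1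
    obtain ⟨b, hvb⟩ := h1.nonempty_neighborSet_left (hφadj v hv).ne
    have h2 := SimpleGraph.deleteEdges_adj.1 hvb
    refine ⟨b, ?_, ?_, h2.1⟩
    · by_contra hbW
      exact hiso b hbW h2.1
    · rintro rfl
      exact h2.2 rfl
  have : Nonempty V := hG.nonempty
  choose! b hbW hbne hbadj using hsecond
  -- `I`, `X` and `Y` partition the complement of `W`
  let I : Set V := {v | v ∉ W ∧ ∀ u, u ∉ W → ¬ G.Adj v u}
  let Y : Set V := {v | v ∉ W ∧ v ∉ X ∧ ∃ u, u ∉ W ∧ G.Adj v u}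
  have hIW : ∀ v ∈ I, v ∉ W := fun v h => h.1
  have hXW : ∀ v ∈ X, v ∉ W := fun v h => (hXN h).1
  have hYW : ∀ v ∈ Y, v ∉ W := fun v h => h.1
  have hXI : ∀ v ∈ X, v ∉ I := by
    rintro v hv ⟨-, hI⟩
    obtain ⟨-, u, hu, h⟩ := hXN hv
    exact hI u hu h
  have hYI : ∀ v ∈ Y, v ∉ I := by
    rintro v ⟨-, -, u, hu, h⟩ ⟨-, hI⟩
    exact hI u hu h
  have hXY : ∀ v ∈ X, v ∉ Y := fun v hv h => h.2.1 hv
  let P : V → V → Prop := fun x y => A x y ∨ (x = φ y ∧ (y ∈ I ∨ y ∈ X)) ∨ (x ∈ I ∧ y = b x) ∨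
    (x ∈ X ∧ y ∈ Y ∧ G.Adj x y) ∨ (x ∈ Y ∧ y = φ x)
  have hPG : ∀ x y, P x y → G.Adj x y := by
    rintro x y (h | ⟨rfl, h | h⟩ | ⟨h, rfl⟩ | ⟨-, -, h⟩ | ⟨h, rfl⟩)
    exacts [hA.adj h, (hφadj y (hIW y h)).symm, (hφadj y (hXW y h)).symm, hbadj x h, h,
      hφadj x (hYW x h)]
  have hPasymm : ∀ x y, P x y → ¬ P y x := by
    have h1 : ∀ {x y}, A x y → x ∈ W := hA.fst_mem
    have h2 : ∀ {x y}, A x y → y ∈ W := hA.snd_mem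
    have h3 : ∀ {x y}, A x y → ¬ A y x := hA.asymm
    have h4 : ∀ v ∈ I, b v ∈ W := fun v hv => hbW v hv
    have h5 : ∀ v ∈ I, b v ≠ φ v := fun v hv => hbne v hv
    rintro x y (h | ⟨rfl, h | h⟩ | ⟨h, rfl⟩ | ⟨h, h', -⟩ | ⟨h, rfl⟩)
      (g | ⟨g', g | g⟩ | ⟨g, g'⟩ | ⟨g, g', -⟩ | ⟨g, g'⟩) <;> grind
  obtain ⟨O, hO, hPO⟩ := exists_isOrientation_ge hPG hPasymm
  have hear : ∀ v, ∃ S E, IsDirectedEar O.Adj W S E ∧ E.card ≤ 3 ∧ (v ∈ W ∨ v ∈ S) := by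
    have htri : ∀ x ∈ X, ∀ y ∈ Y, G.Adj x y →
        IsDirectedEar O.Adj W {x, y} {(φ x, x), (x, y), (y, φ y)} := by
      intro x hx y hy hxy
      refine ⟨?_, ?_, ?_, ?_, ?_⟩
      · intro a c h
        simp only [Finset.mem_insert, Finset.mem_singleton, Prod.mk.injEq] at h
        rcases h with ⟨rfl, rfl⟩ | ⟨rfl, rfl⟩ | ⟨rfl, rfl⟩
        · exact hPO _ _ (Or.inr (Or.inl ⟨rfl, Or.inr hx⟩))
        · exact hPO _ _ (Or.inr (Or.inr (Or.inr (Or.inl ⟨hx, hy, hxy⟩))))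
        · exact hPO _ _ (Or.inr (Or.inr (Or.inr (Or.inr ⟨hy, rfl⟩))))
      · intro a c h
        simp only [Finset.mem_insert, Finset.mem_singleton, Prod.mk.injEq] at h ⊢
        rcases h with ⟨rfl, rfl⟩ | ⟨rfl, rfl⟩ | ⟨rfl, rfl⟩
        exacts [Or.inl (hφW _), by simp, by simp]
      · intro a c h
        simp only [Finset.mem_insert, Finset.mem_singleton, Prod.mk.injEq] at h ⊢
        rcases h with ⟨rfl, rfl⟩ | ⟨rfl, rfl⟩ | ⟨rfl, rfl⟩
        exacts [by simp, by simp, Or.inl (hφW _)]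
      · intro a ha
        simp only [Finset.mem_insert, Finset.mem_singleton] at ha
        refine ⟨φ x, hφW x, ?_⟩
        rcases ha with rfl | rfl
        · exact .single (by simp)
        · exact (Relation.ReflTransGen.single (by simp)).tail (b := x) (by simp)
      · intro a ha
        simp only [Finset.mem_insert, Finset.mem_singleton] at ha
        refine ⟨φ y, hφW y, ?_⟩
        rcases ha with rfl | rfl
        · exact (Relation.ReflTransGen.single (by simp)).tail (b := y) (by simp)
        · exact .single (by simp)
    intro v
    by_cases hvW : v ∈ W
    · exact ⟨∅, ∅, ⟨by simp, by simp, by simp, by simp, by simp⟩, by simp, Or.inl hvW⟩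
    by_cases hvI : v ∈ I
    · refine ⟨{v}, {(φ v, v), (v, b v)}, ⟨?_, ?_, ?_, ?_, ?_⟩,
        Finset.card_le_two.trans (by norm_num), Or.inr (by simp)⟩
      · intro a c h
        simp only [Finset.mem_insert, Finset.mem_singleton, Prod.mk.injEq] at h
        rcases h with ⟨rfl, rfl⟩ | ⟨rfl, rfl⟩
        · exact hPO _ _ (Or.inr (Or.inl ⟨rfl, Or.inl hvI⟩))
        · exact hPO _ _ (Or.inr (Or.inr (Or.inl ⟨hvI, rfl⟩)))
      · intro a c h
        simp only [Finset.mem_insert, Finset.mem_singleton, Prod.mk.injEq] at h ⊢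
        rcases h with ⟨rfl, rfl⟩ | ⟨rfl, rfl⟩
        exacts [Or.inl (hφW _), Or.inr rfl]
      · intro a c h
        simp only [Finset.mem_insert, Finset.mem_singleton, Prod.mk.injEq] at h ⊢
        rcases h with ⟨rfl, rfl⟩ | ⟨rfl, rfl⟩
        exacts [Or.inr rfl, Or.inl (hbW _ hvI)]
      · intro a ha
        rw [Finset.mem_singleton] at ha
        subst ha
        exact ⟨φ a, hφW a, .single (by simp)⟩
      · intro a ha
        rw [Finset.mem_singleton] at ha
        subst ha
        exact ⟨b a, hbW a hvI, .single (by simp)⟩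
    have hvN : v ∉ W ∧ ∃ u, u ∉ W ∧ G.Adj v u := by
      refine ⟨hvW, ?_⟩
      by_contra! hcon
      exact hvI ⟨hvW, hcon⟩
    by_cases hvX : v ∈ X
    · obtain ⟨u, hu, huX, h⟩ := hX v hvX
      exact ⟨_, _, htri v hvX u ⟨hu.1, huX, hu.2⟩ h, Finset.card_le_three, by simp⟩
    · obtain ⟨u, hu, h⟩ := hY v hvN hvX
      exact ⟨_, _, htri u hu v ⟨hvW, hvX, hvN.2⟩ h, Finset.card_le_three, by simp⟩
  have hpair : ∀ u v, Relation.ReflTransGen O.Adj u v ∧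
      strongDist O u v ≤ ((7 * (D.card - 1) + 6 : ℕ) : ℕ∞) := by
    intro u v
    obtain ⟨S₁, E₁, h₁, hc₁, hu⟩ := hear u
    obtain ⟨S₂, E₂, h₂, hc₂, hv⟩ := hear v
    exact strongDist_le_of_ears hA (fun a c h => hPO a c (Or.inl h)) hm h₁ h₂ hc₁ hc₂ hu hv
  refine (iInf₂_le O ⟨hO, fun u v => (hpair u v).1⟩).trans (iSup₂_le fun u v => ?_)
  refine (hpair u v).2.trans ?_
  have : 0 < D.card := Finset.card_pos.2 ⟨_, hφ.mem (Classical.arbitrary V)⟩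
  exact_mod_cast (by omega : 7 * (D.card - 1) + 6 ≤ 7 * D.card - 1)

/-! ### The extremal graphs -/

theorem ExtremalRel.ne {n : ℕ} {c : Fin n → Bool} {a b : ExtremalVertex n}
    (h : ExtremalRel n c a b) : a ≠ b := by
  rintro rfl
  cases h

theorem ExtremalRel.adj {n : ℕ} {c : Fin n → Bool} {a b : ExtremalVertex n}
    (h : ExtremalRel n c a b) : (extremalGraph n c).Adj a b :=
  (SimpleGraph.fromRel_adj _ _ _).2 ⟨h.ne, Or.inl h⟩

theorem extremalGraph_adj {n : ℕ} {c : Fin n → Bool} {a b : ExtremalVertex n} :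
    (extremalGraph n c).Adj a b ↔ ExtremalRel n c a b ∨ ExtremalRel n c b a := by
  refine ⟨fun h => ((SimpleGraph.fromRel_adj _ _ _).1 h).2, ?_⟩
  rintro (h | h)
  exacts [h.adj, h.adj.symm]

theorem finite_extremalVertex (n : ℕ) : Finite (ExtremalVertex n) := by
  let f : Fin (n + 1) ⊕ (Fin n × Bool) ⊕ (Fin n × Bool) ⊕ Bool ⊕ Bool → ExtremalVertex n :=
    fun x => match x with
    | .inl i => .hub i
    | .inr (.inl (i, k)) => .left i k
    | .inr (.inr (.inl (i, k))) => .right i k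
    | .inr (.inr (.inr (.inl k))) => .first k
    | .inr (.inr (.inr (.inr k))) => .last k
  refine Finite.of_surjective f ?_
  rintro (i | ⟨i, k⟩ | ⟨i, k⟩ | k | k)
  exacts [⟨.inl i, rfl⟩, ⟨.inr (.inl (i, k)), rfl⟩, ⟨.inr (.inr (.inl (i, k))), rfl⟩,
    ⟨.inr (.inr (.inr (.inl k))), rfl⟩, ⟨.inr (.inr (.inr (.inr k))), rfl⟩]

theorem extremalGraph_connected (n : ℕ) (c : Fin n → Bool) : (extremalGraph n c).Connected := by
  have hr : ∀ {a b}, ExtremalRel n c a b → (extremalGraph n c).Reachable a b :=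
    fun h => h.adj.reachable
  have hhub : ∀ i, (extremalGraph n c).Reachable (.hub 0) (.hub i) := by
    intro i
    induction i using Fin.induction with
    | zero => exact .rfl
    | succ i ih =>
      have hmid : (extremalGraph n c).Reachable (.left i true) (.right i true) := by
        cases h : c i
        · exact hr (.left_right i h true)
        · exact (hr (.right_left i h true)).symm
      exact ih.trans ((hr (.hub_left i true)).trans (hmid.trans (hr (.hub_right i true)).symm))
  rw [SimpleGraph.connected_iff_exists_forall_reachable]
  refine ⟨.hub 0, ?_⟩
  rintro (i | ⟨i, k⟩ | ⟨i, k⟩ | k | k)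
  exacts [hhub i, (hhub _).trans (hr (.hub_left i k)), (hhub _).trans (hr (.hub_right i k)),
    hr (.hub_first k), (hhub _).trans (hr (.hub_last k))]

theorem SimpleGraph.reachable_deleteEdges_of_triangle {V : Type*} {G : SimpleGraph V} {a b w : V}
    (h₁ : G.Adj a w) (h₂ : G.Adj w b) : (G.deleteEdges {s(a, b)}).Reachable a b := by
  refine (SimpleGraph.Adj.reachable (v := w) ?_).trans (SimpleGraph.Adj.reachable ?_) <;>
    rw [SimpleGraph.deleteEdges_adj]
  · exact ⟨h₁, fun h => h₂.ne (Sym2.congr_right.1 h)⟩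
  · exact ⟨h₂, fun h => h₁.ne (Sym2.congr_left.1 h).symm⟩

theorem SimpleGraph.reachable_deleteEdges_of_square {V : Type*} {G : SimpleGraph V}
    {a b w w' : V} (h₁ : G.Adj a w) (h₂ : G.Adj w w') (h₃ : G.Adj w' b) (hw : w ≠ b)
    (hw' : w' ≠ a) : (G.deleteEdges {s(a, b)}).Reachable a b := by
  refine ((SimpleGraph.Adj.reachable (v := w) ?_).trans
    (SimpleGraph.Adj.reachable (v := w') ?_)).trans (SimpleGraph.Adj.reachable ?_) <;>
    rw [SimpleGraph.deleteEdges_adj]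
  · exact ⟨h₁, fun h => hw (Sym2.congr_right.1 h)⟩
  · refine ⟨h₂, fun h => ?_⟩
    rcases Sym2.eq_iff.1 h with ⟨h, -⟩ | ⟨h, -⟩
    exacts [h₁.ne h.symm, hw h]
  · exact ⟨h₃, fun h => hw' (Sym2.congr_left.1 h)⟩

theorem extremalGraph_isBridgeless (n : ℕ) (c : Fin n → Bool) :
    IsBridgeless (extremalGraph n c) := by
  suffices H : ∀ a b, ExtremalRel n c a b →
      ((extremalGraph n c).deleteEdges {s(a, b)}).Reachable a b by
    intro e he
    induction e with
    | h a b =>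
      rw [SimpleGraph.isBridge_iff, not_not]
      rcases extremalGraph_adj.1 he with h | h
      · exact H a b h
      · rw [Sym2.eq_swap]
        exact (H b a h).symm
  have hll : ∀ i k, c i = false → (extremalGraph n c).Adj (.left i (!k)) (.left i k) := by
    rintro i (_ | _) h
    exacts [(ExtremalRel.left_left i h).adj, (ExtremalRel.left_left i h).adj.symm]
  have hrr : ∀ i k, c i = true → (extremalGraph n c).Adj (.right i (!k)) (.right i k) := by
    rintro i (_ | _) h
    exacts [(ExtremalRel.right_right i h).adj, (ExtremalRel.right_right i h).adj.symm]
  have hff : ∀ k, (extremalGraph n c).Adj (.first (!k)) (.first k) := by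
    rintro (_ | _)
    exacts [ExtremalRel.first_first.adj, ExtremalRel.first_first.adj.symm]
  have hee : ∀ k, (extremalGraph n c).Adj (.last (!k)) (.last k) := by
    rintro (_ | _)
    exacts [ExtremalRel.last_last.adj, ExtremalRel.last_last.adj.symm]
  intro a b h
  cases h with
  | hub_left i k =>
    cases h : c i
    · exact SimpleGraph.reachable_deleteEdges_of_triangle
        (ExtremalRel.hub_left i (!k)).adj (hll i k h)
    · exact SimpleGraph.reachable_deleteEdges_of_square (ExtremalRel.hub_left i (!k)).adj
        (ExtremalRel.right_left i h (!k)).adj.symm (ExtremalRel.right_left i h k).adj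
        (by simp) (by simp)
  | hub_right i k =>
    cases h : c i
    · exact SimpleGraph.reachable_deleteEdges_of_square (ExtremalRel.hub_right i (!k)).adj
        (ExtremalRel.left_right i h (!k)).adj.symm (ExtremalRel.left_right i h k).adj
        (by simp) (by simp)
    · exact SimpleGraph.reachable_deleteEdges_of_triangle
        (ExtremalRel.hub_right i (!k)).adj (hrr i k h)
  | left_left i h =>
    exact SimpleGraph.reachable_deleteEdges_of_triangle (ExtremalRel.hub_left i true).adj.symm
      (ExtremalRel.hub_left i false).adj
  | left_right i h k =>
    exact SimpleGraph.reachable_deleteEdges_of_square (ExtremalRel.left_right i h (!k)).adj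
      (ExtremalRel.hub_right i (!k)).adj.symm (ExtremalRel.hub_right i k).adj (by simp) (by simp)
  | right_right i h =>
    exact SimpleGraph.reachable_deleteEdges_of_triangle (ExtremalRel.hub_right i true).adj.symm
      (ExtremalRel.hub_right i false).adj
  | right_left i h k =>
    exact SimpleGraph.reachable_deleteEdges_of_square (ExtremalRel.right_left i h (!k)).adj
      (ExtremalRel.hub_left i (!k)).adj.symm (ExtremalRel.hub_left i k).adj (by simp) (by simp)
  | hub_first k =>
    exact SimpleGraph.reachable_deleteEdges_of_triangle (ExtremalRel.hub_first (!k)).adj (hff k)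
  | first_first =>
    exact SimpleGraph.reachable_deleteEdges_of_triangle (ExtremalRel.hub_first true).adj.symm
      (ExtremalRel.hub_first false).adj
  | hub_last k =>
    exact SimpleGraph.reachable_deleteEdges_of_triangle (ExtremalRel.hub_last (!k)).adj (hee k)
  | last_last =>
    exact SimpleGraph.reachable_deleteEdges_of_triangle (ExtremalRel.hub_last true).adj.symm
      (ExtremalRel.hub_last false).adj

/-- The unique path vertex that is equal or adjacent to the given vertex. -/
def nearestHub {n : ℕ} : ExtremalVertex n → Fin (n + 1)
  | .hub i => i
  | .left i _ => i.castSucc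
  | .right i _ => i.succ
  | .first _ => 0
  | .last _ => Fin.last n

theorem mem_extremalHubs {n : ℕ} {v : ExtremalVertex n} :
    v ∈ extremalHubs n ↔ ∃ i, v = .hub i := by
  simp only [extremalHubs, Finset.mem_map, Finset.mem_univ, true_and]
  exact exists_congr fun _ => eq_comm

theorem card_extremalHubs (n : ℕ) : (extremalHubs n).card = n + 1 := by
  simp [extremalHubs]

theorem extremalHubs_isDominatingSet (n : ℕ) (c : Fin n → Bool) :
    IsDominatingSet (extremalGraph n c) (extremalHubs n) := by
  rintro (i | ⟨i, k⟩ | ⟨i, k⟩ | k | k) hv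
  · exact absurd (mem_extremalHubs.2 ⟨i, rfl⟩) hv
  · exact ⟨_, mem_extremalHubs.2 ⟨_, rfl⟩, (ExtremalRel.hub_left i k).adj.symm⟩
  · exact ⟨_, mem_extremalHubs.2 ⟨_, rfl⟩, (ExtremalRel.hub_right i k).adj.symm⟩
  · exact ⟨_, mem_extremalHubs.2 ⟨_, rfl⟩, (ExtremalRel.hub_first k).adj.symm⟩
  · exact ⟨_, mem_extremalHubs.2 ⟨_, rfl⟩, (ExtremalRel.hub_last k).adj.symm⟩

/-- The closed neighbourhoods of the path vertices are disjoint, so a dominating set has at least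
`n + 1` elements. -/
theorem extremalGraph_hasDominationNumber (n : ℕ) (c : Fin n → Bool) :
    HasDominationNumber (extremalGraph n c) (n + 1) := by
  classical
  refine ⟨⟨extremalHubs n, extremalHubs_isDominatingSet n c, card_extremalHubs n⟩, ?_⟩
  rintro _ ⟨D, hD, rfl⟩
  have hadj : ∀ i d, (extremalGraph n c).Adj (.hub i) d → nearestHub d = i := by
    intro i d h
    rcases extremalGraph_adj.1 h with h | h <;> cases h <;> rfl
  have himage : (Finset.univ : Finset (Fin (n + 1))) ⊆ D.image nearestHub := by
    intro i _
    rw [Finset.mem_image]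
    by_cases hi : .hub i ∈ D
    · exact ⟨_, hi, rfl⟩
    · obtain ⟨d, hd, h⟩ := hD _ hi
      exact ⟨d, hd, hadj i d h⟩
  have := (Finset.card_le_card himage).trans Finset.card_image_le
  simpa using this

/-! ### Lower bound for the extremal graphs -/

/-- The level of a vertex. Exactly two edges join the vertices of level at most `t` to the others,
for every `t ≤ 4 n + 3`, and every edge lies in such a cut. -/
def extremalLevel {n : ℕ} (c : Fin n → Bool) : ExtremalVertex n → ℕ
  | .hub i => 4 * i + 2
  | .left i k => if c i = false ∧ k = true then 4 * i + 4 else 4 * i + 3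
  | .right i k => if c i = true ∧ k = true then 4 * i + 4 else 4 * i + 5
  | .first k => if k = true then 0 else 1
  | .last k => if k = true then 4 * n + 4 else 4 * n + 3

/-- The edge `ab` joins a vertex of level at most `t` to one of higher level. -/
def CrossesLevel {n : ℕ} (c : Fin n → Bool) (t : ℕ) (a b : ExtremalVertex n) : Prop :=
  (extremalLevel c a ≤ t ∧ t < extremalLevel c b) ∨ (extremalLevel c b ≤ t ∧ t < extremalLevel c a)


/-! The following lemmas list the two edges of the cuts given by the levels. -/

section

variable {n : ℕ} {c : Fin n → Bool} {a b : ExtremalVertex n}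

theorem cut_hub_left (i : Fin n) (h : ExtremalRel n c a b)
    (hx : CrossesLevel c (4 * i + 2) a b) :
    s(a, b) = s(.hub i.castSucc, .left i true) ∨ s(a, b) = s(.hub i.castSucc, .left i false) := by
  cases h <;> try (rename_i k; cases k)
  all_goals simp only [CrossesLevel, extremalLevel, Fin.val_castSucc, Fin.val_succ, Fin.val_last,
    Fin.val_zero, and_true, and_false, reduceCtorEq, if_true, if_false] at hx
  all_goals first | omega | grind

theorem cut_hub_right (i : Fin n) (h : ExtremalRel n c a b)
    (hx : CrossesLevel c (4 * i + 5) a b) :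
    s(a, b) = s(.hub i.succ, .right i true) ∨ s(a, b) = s(.hub i.succ, .right i false) := by
  cases h <;> try (rename_i k; cases k)
  all_goals simp only [CrossesLevel, extremalLevel, Fin.val_castSucc, Fin.val_succ, Fin.val_last,
    Fin.val_zero, and_true, and_false, reduceCtorEq, if_true, if_false] at hx
  all_goals first | omega | grind

theorem cut_left_left (i : Fin n) (hc : c i = false) (h : ExtremalRel n c a b)
    (hx : CrossesLevel c (4 * i + 3) a b) :
    s(a, b) = s(.left i true, .left i false) ∨ s(a, b) = s(.hub i.castSucc, .left i true) := by
  cases h <;> try (rename_i k; cases k)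
  all_goals simp only [CrossesLevel, extremalLevel, Fin.val_castSucc, Fin.val_succ, Fin.val_last,
    Fin.val_zero, and_true, and_false, reduceCtorEq, if_true, if_false] at hx
  all_goals first | omega | grind

theorem cut_left_right (i : Fin n) (hc : c i = false) (h : ExtremalRel n c a b)
    (hx : CrossesLevel c (4 * i + 4) a b) :
    s(a, b) = s(.left i true, .right i true) ∨ s(a, b) = s(.left i true, .right i false) := by
  cases h <;> try (rename_i k; cases k)
  all_goals simp only [CrossesLevel, extremalLevel, Fin.val_castSucc, Fin.val_succ, Fin.val_last,
    Fin.val_zero, and_true, and_false, reduceCtorEq, if_true, if_false] at hx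
  all_goals first | omega | grind

theorem cut_right_right (i : Fin n) (hc : c i = true) (h : ExtremalRel n c a b)
    (hx : CrossesLevel c (4 * i + 4) a b) :
    s(a, b) = s(.right i true, .right i false) ∨ s(a, b) = s(.hub i.succ, .right i true) := by
  cases h <;> try (rename_i k; cases k)
  all_goals simp only [CrossesLevel, extremalLevel, Fin.val_castSucc, Fin.val_succ, Fin.val_last,
    Fin.val_zero, and_true, and_false, reduceCtorEq, if_true, if_false] at hx
  all_goals first | omega | grind

theorem cut_right_left (i : Fin n) (hc : c i = true) (h : ExtremalRel n c a b)
    (hx : CrossesLevel c (4 * i + 3) a b) :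
    s(a, b) = s(.right i true, .left i true) ∨ s(a, b) = s(.right i true, .left i false) := by
  cases h <;> try (rename_i k; cases k)
  all_goals simp only [CrossesLevel, extremalLevel, Fin.val_castSucc, Fin.val_succ, Fin.val_last,
    Fin.val_zero, and_true, and_false, reduceCtorEq, if_true, if_false] at hx
  all_goals first | omega | grind

theorem cut_first_first (h : ExtremalRel n c a b)
    (hx : CrossesLevel c (0) a b) :
    s(a, b) = s(.first true, .first false) ∨ s(a, b) = s(.hub 0, .first true) := by
  cases h <;> try (rename_i k; cases k)
  all_goals simp only [CrossesLevel, extremalLevel, Fin.val_castSucc, Fin.val_succ, Fin.val_last,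
    Fin.val_zero, and_true, and_false, reduceCtorEq, if_true, if_false] at hx
  all_goals first | omega | grind

theorem cut_hub_first (h : ExtremalRel n c a b)
    (hx : CrossesLevel c (1) a b) :
    s(a, b) = s(.hub 0, .first true) ∨ s(a, b) = s(.hub 0, .first false) := by
  cases h <;> try (rename_i k; cases k)
  all_goals simp only [CrossesLevel, extremalLevel, Fin.val_castSucc, Fin.val_succ, Fin.val_last,
    Fin.val_zero, and_true, and_false, reduceCtorEq, if_true, if_false] at hx
  all_goals first | omega | grind

theorem cut_last_last (h : ExtremalRel n c a b)
    (hx : CrossesLevel c (4 * n + 3) a b) :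
    s(a, b) = s(.last true, .last false) ∨ s(a, b) = s(.hub (Fin.last n), .last true) := by
  cases h <;> try (rename_i k; cases k)
  all_goals simp only [CrossesLevel, extremalLevel, Fin.val_castSucc, Fin.val_succ, Fin.val_last,
    Fin.val_zero, and_true, and_false, reduceCtorEq, if_true, if_false] at hx
  all_goals first | omega | grind

theorem cut_hub_last (h : ExtremalRel n c a b)
    (hx : CrossesLevel c (4 * n + 2) a b) :
    s(a, b) = s(.hub (Fin.last n), .last true) ∨ s(a, b) = s(.hub (Fin.last n), .last false) := by
  cases h <;> try (rename_i k; cases k)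
  all_goals simp only [CrossesLevel, extremalLevel, Fin.val_castSucc, Fin.val_succ, Fin.val_last,
    Fin.val_zero, and_true, and_false, reduceCtorEq, if_true, if_false] at hx
  all_goals first | omega | grind

end

/-- If only two edges leave a vertex set that separates `u` from `v`, then every strong subgraph
containing `u` and `v` uses both of them: one to leave the set and one to return. -/
theorem SubDigraph.IsStrong.uses_two_cut {V : Type*} {G : SimpleGraph V} {O : Digraph V}
    (hO : IsOrientation G O) {H : SubDigraph O} (hH : H.IsStrong) {u v : V} (hu : u ∈ H.verts)
    (hv : v ∈ H.verts) {S : Set V} (huS : u ∈ S) (hvS : v ∉ S) {e₁ e₂ : Sym2 V}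
    (hcut : ∀ a b, G.Adj a b → a ∈ S → b ∉ S → s(a, b) = e₁ ∨ s(a, b) = e₂) :
    (∃ a b, H.Adj a b ∧ s(a, b) = e₁) ∧ (∃ a b, H.Adj a b ∧ s(a, b) = e₂) := by
  have key : ∀ {x y}, Relation.ReflTransGen H.Adj x y → ∀ T : Set V, x ∈ T → y ∉ T →
      ∃ a b, H.Adj a b ∧ a ∈ T ∧ b ∉ T := by
    intro x y h T hx hy
    induction h with
    | refl => exact absurd hx hy
    | @tail b c _ hbc ih =>
      by_cases hb : b ∈ T
      · exact ⟨b, c, hbc, hb, hy⟩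
      · exact ih hb
  obtain ⟨a, b, hab, ha, hb⟩ := key (hH u hu v hv) S huS hvS
  obtain ⟨b', a', hba, hb', ha'⟩ := key (hH v hv u hu) Sᶜ hvS (by simpa using huS)
  rw [Set.mem_compl_iff, not_not] at ha'
  have h1 := hcut a b ((hO.adj_iff a b).2 (Or.inl (H.adj_sub hab))) ha hb
  have h2 := hcut a' b' ((hO.adj_iff a' b').2 (Or.inr (H.adj_sub hba))) ha' hb'
  have hne : s(a, b) ≠ s(a', b') := by
    intro h
    rcases Sym2.eq_iff.1 h with ⟨rfl, rfl⟩ | ⟨rfl, rfl⟩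
    · exact hO.asymm _ _ (H.adj_sub hab) (H.adj_sub hba)
    · exact hb' ha
  rw [Sym2.eq_swap (a := a')] at h2 hne
  rcases h1 with h1 | h1 <;> rcases h2 with h2 | h2
  · exact absurd (h1.trans h2.symm) hne
  · exact ⟨⟨a, b, hab, h1⟩, ⟨b', a', hba, h2⟩⟩
  · exact ⟨⟨b', a', hba, h2⟩, ⟨a, b, hab, h1⟩⟩
  · exact absurd (h1.trans h2.symm) hne

/-- A strong subgraph that contains a vertex of the first and one of the last triangle uses every
edge of the extremal graph. -/
theorem extremalGraph_uses_all {n : ℕ} {c : Fin n → Bool} {O : Digraph (ExtremalVertex n)}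
    (hO : IsOrientation (extremalGraph n c) O) {H : SubDigraph O} (hH : H.IsStrong)
    (hu : .first true ∈ H.verts) (hv : .last true ∈ H.verts) {a b : ExtremalVertex n}
    (hab : ExtremalRel n c a b) : ∃ x y, H.Adj x y ∧ s(x, y) = s(a, b) := by
  have cut : ∀ (t : ℕ) (e₁ e₂ : Sym2 (ExtremalVertex n)), t < 4 * n + 4 →
      (∀ a b, ExtremalRel n c a b → CrossesLevel c t a b → s(a, b) = e₁ ∨ s(a, b) = e₂) →
      (∃ a b, H.Adj a b ∧ s(a, b) = e₁) ∧ (∃ a b, H.Adj a b ∧ s(a, b) = e₂) := by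
    intro t e₁ e₂ ht h
    refine hH.uses_two_cut hO hu hv (S := {a | extremalLevel c a ≤ t}) (by simp [extremalLevel])
      (by simpa [extremalLevel] using ht) fun a b hadj ha hb => ?_
    rw [Set.mem_ofPred_eq] at ha hb
    rcases extremalGraph_adj.1 hadj with hr | hr
    · exact h a b hr (Or.inl ⟨ha, not_le.1 hb⟩)
    · rw [Sym2.eq_swap]
      exact h b a hr (Or.inr ⟨ha, not_le.1 hb⟩)
  have h_hub_left := fun i => cut _ _ _ (by omega) fun _ _ => cut_hub_left (c := c) i
  have h_hub_right := fun i => cut _ _ _ (by omega) fun _ _ => cut_hub_right (c := c) i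
  have h_left_left := fun i hc => cut _ _ _ (by omega) fun _ _ => cut_left_left (c := c) i hc
  have h_left_right := fun i hc => cut _ _ _ (by omega) fun _ _ => cut_left_right (c := c) i hc
  have h_right_right := fun i hc => cut _ _ _ (by omega) fun _ _ => cut_right_right (c := c) i hc
  have h_right_left := fun i hc => cut _ _ _ (by omega) fun _ _ => cut_right_left (c := c) i hc
  have h_first_first := cut _ _ _ (by omega) fun _ _ => cut_first_first (c := c)
  have h_hub_first := cut _ _ _ (by omega) fun _ _ => cut_hub_first (c := c)
  have h_last_last := cut _ _ _ (by omega) fun _ _ => cut_last_last (c := c)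
  have h_hub_last := cut _ _ _ (by omega) fun _ _ => cut_hub_last (c := c)
  cases hab with
  | hub_left i k => cases k; exacts [(h_hub_left i).2, (h_hub_left i).1]
  | hub_right i k => cases k; exacts [(h_hub_right i).2, (h_hub_right i).1]
  | left_left i h => exact (h_left_left i h).1
  | left_right i h k => cases k; exacts [(h_left_right i h).2, (h_left_right i h).1]
  | right_right i h => exact (h_right_right i h).1
  | right_left i h k => cases k; exacts [(h_right_left i h).2, (h_right_left i h).1]
  | hub_first k => cases k; exacts [h_hub_first.2, h_hub_first.1]
  | first_first => exact h_first_first.1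
  | hub_last k => cases k; exacts [h_hub_last.2, h_hub_last.1]
  | last_last => exact h_last_last.1

/-- Names for the edges of the extremal graph: two at each end of a gadget and three inside it, and
three for each end triangle. -/
abbrev ExtremalEdge (n : ℕ) : Type :=
  (Fin n × Bool) ⊕ (Fin n × Bool) ⊕ (Fin n × Option Bool) ⊕ Option Bool ⊕ Option Bool

/-- The ends of a named edge. -/
def extremalEnds {n : ℕ} (c : Fin n → Bool) :
    ExtremalEdge n → ExtremalVertex n × ExtremalVertex n
  | .inl (i, k) => (.hub i.castSucc, .left i k)
  | .inr (.inl (i, k)) => (.hub i.succ, .right i k)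
  | .inr (.inr (.inl (i, none))) =>
    if c i = true then (.right i true, .right i false) else (.left i true, .left i false)
  | .inr (.inr (.inl (i, some k))) =>
    if c i = true then (.right i true, .left i k) else (.left i true, .right i k)
  | .inr (.inr (.inr (.inl none))) => (.first true, .first false)
  | .inr (.inr (.inr (.inl (some k)))) => (.hub 0, .first k)
  | .inr (.inr (.inr (.inr none))) => (.last true, .last false)
  | .inr (.inr (.inr (.inr (some k)))) => (.hub (Fin.last n), .last k)

theorem extremalRel_extremalEnds {n : ℕ} (c : Fin n → Bool) (e : ExtremalEdge n) :
    ExtremalRel n c (extremalEnds c e).1 (extremalEnds c e).2 := by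
  rcases e with ⟨i, k⟩ | ⟨i, k⟩ | ⟨i, _ | k⟩ | (_ | k) | (_ | k)
  · exact .hub_left i k
  · exact .hub_right i k
  · cases h : c i <;> simp only [extremalEnds, h]
    exacts [.left_left i h, .right_right i h]
  · cases h : c i <;> simp only [extremalEnds, h]
    exacts [.left_right i h k, .right_left i h k]
  · exact .first_first
  · exact .hub_first k
  · exact .last_last
  · exact .hub_last k

theorem extremalEnds_injective {n : ℕ} (c : Fin n → Bool) :
    Function.Injective (extremalEnds c) := by
  rintro (⟨i, k⟩ | ⟨i, k⟩ | ⟨i, _ | k⟩ | (_ | k) | (_ | k))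
    (⟨j, l⟩ | ⟨j, l⟩ | ⟨j, _ | l⟩ | (_ | l) | (_ | l)) h <;>
    simp only [extremalEnds] at h <;> grind

theorem ExtremalRel.asymm {n : ℕ} {c : Fin n → Bool} {a b : ExtremalVertex n}
    (h : ExtremalRel n c a b) : ¬ ExtremalRel n c b a := by
  intro h'
  cases h <;> cases h' <;> simp_all

/-- Every strong orientation of the extremal graph has strong diameter at least `7 (n + 1) - 1`. -/
theorem le_orientedStrongDiam_extremalGraph (n : ℕ) (c : Fin n → Bool) :
    ((7 * (n + 1) - 1 : ℕ) : ℕ∞) ≤ orientedStrongDiam (extremalGraph n c) := by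
  refine le_iInf₂ fun O hO => ?_
  refine le_trans ?_ (le_iSup₂ (f := fun u v => strongDist O u v) (.first true) (.last true))
  refine le_iInf₂ fun H hH => le_iInf₂ fun hu hv => ?_
  have h1 : (Set.range (extremalEnds c)).encard = ((7 * (n + 1) - 1 : ℕ) : ℕ∞) := by
    rw [← Set.image_univ, (extremalEnds_injective c).encard_image, Set.encard_univ,
      ENat.card_eq_coe_fintype_card]
    simp only [Fintype.card_sum, Fintype.card_prod, Fintype.card_fin, Fintype.card_bool,
      Fintype.card_option]
    congr 1
    omega
  have hinj : Set.InjOn (fun p : ExtremalVertex n × ExtremalVertex n => s(p.1, p.2))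
      (Set.range (extremalEnds c)) := by
    rintro _ ⟨e, rfl⟩ _ ⟨f, rfl⟩ h
    rcases Sym2.eq_iff.1 h with ⟨h1, h2⟩ | ⟨h1, h2⟩
    · exact Prod.ext h1 h2
    · have h3 := extremalRel_extremalEnds c e
      rw [h1, h2] at h3
      exact absurd h3 (extremalRel_extremalEnds c f).asymm
  rw [← h1, ← hinj.encard_image]
  refine le_trans (Set.encard_le_encard ?_)
    (Set.encard_image_le (fun p : ExtremalVertex n × ExtremalVertex n => s(p.1, p.2)) _)
  rintro _ ⟨_, ⟨e, rfl⟩, rfl⟩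
  obtain ⟨x, y, hxy, h⟩ := extremalGraph_uses_all hO.1 hH hu hv (extremalRel_extremalEnds c e)
  exact ⟨(x, y), hxy, h⟩

/-! ### The sharp bound -/

theorem theorem1p8 :
    (∀ (V : Type*) [Finite V] (G : SimpleGraph V) (D : Finset V),
      G.Connected → IsBridgeless G → IsDominatingSet G D →
        orientedStrongDiam G ≤ ((7 * D.card - 1 : ℕ) : ℕ∞)) ∧
    (∀ (n : ℕ) (c : Fin n → Bool),
      Finite (ExtremalVertex n) ∧
      (extremalGraph n c).Connected ∧
      IsBridgeless (extremalGraph n c) ∧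
      IsDominatingSet (extremalGraph n c) (extremalHubs n) ∧
      (extremalHubs n).card = n + 1 ∧
      HasDominationNumber (extremalGraph n c) (n + 1) ∧
      orientedStrongDiam (extremalGraph n c) = ((7 * (n + 1) - 1 : ℕ) : ℕ∞)) := by
  refine ⟨fun V _ G D hG hb hD => orientedStrongDiam_le_of_isDominatingSet hG hb hD,
    fun n c => ⟨finite_extremalVertex n, extremalGraph_connected n c,
      extremalGraph_isBridgeless n c, extremalHubs_isDominatingSet n c, card_extremalHubs n,
      extremalGraph_hasDominationNumber n c, le_antisymm ?_ ?_⟩⟩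
  · have := finite_extremalVertex n
    have h := orientedStrongDiam_le_of_isDominatingSet (extremalGraph_connected n c)
      (extremalGraph_isBridgeless n c) (extremalHubs_isDominatingSet n c)
    rwa [card_extremalHubs] at h
  · exact le_orientedStrongDiam_extremalGraph n c
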